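/- **Setting.** Let $X$ be a nonempty compact metrizable space and let $\mathcal P(X)$ be the space of Borel probability measures on $X$ with the weak topology. Fix $\mu_0\in\mathcal P(X)$. For each $N$ let $H^{(N)}:X^N\to[-\infty,\infty]$ be a symmetric function that is $\mu_0^{\otimes N}$-measurable. Write $\delta_N(x_1,\dots,x_N)=\frac1N\sum_{i=1}^N\delta_{x_i}\in\mathcal P(X)$ and $$E^{(N)}(\mu^{(N)})=\frac1N\int_{X^N}H^{(N)}\,d\mu^{(N)}$$ for a probability measure $\mu^{(N)}$ on $X^N$. Let $D_{\mu_0}(\mu)\in[0,\infty]$ be the relative entropy of $\mu$ with respect to $\mu_0$: it equals $\int\log\frac{d\mu}{d\mu_0}\,d\mu$ if $\mu\ll\mu_0$, and $\infty$ otherwise. Let $E:\mathcal P(X)\to\,]-\infty,\infty]$ be a functional. Consider the following hypotheses. * **(H1)** $E(\mu_0)<\infty$, and for every $\mu\in\mathcal P(X)$ with $E(\mu)<\infty$ the function $H^{(N)}$ is $\mu^{\otimes N}$-measurable for all large $N$ and $\lim_{N\to\infty}E^{(N)}(\mu^{\otimes N})=E(\mu)$. * **(H2')** For every sequence $x^{(N)}\in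 X^N$ and every $\mu\in\mathcal P(X)$ such that $\delta_N(x^{(N)})\to\mu$ weakly, $$\liminf_{N\to\infty}\frac1N H^{(N)}(x^{(N)})\ge E(\mu).$$ * **(H3)** For every $\mu$ with $E(\mu)<\infty$ there is a sequence $\mu_j\to\mu$ weakly such that each $\mu_j$ is absolutely continuous with respect to $\mu_0$ with $D_{\mu_0}(\mu_j)<\infty$, and $E(\mu_j)\to E(\mu)$. A sequence of Borel measures $\Gamma_N$ on a topological space $Y$ satisfies a large deviation principle (LDP) with speed $r_N$ and rate functional $I$ if $I:Y\to\,]-\infty,\infty]$ is lower semicontinuous and $$\limsup_{N\to\infty}\frac1{r_N}\log\Gamma_N(\mathcal F)\le-\inf_{\mathcal F}I,\qquad \liminf_{N\to\infty}\frac1{r_N}\log\Gamma_N(\mathcal G)\ge-\inf_{\mathcal G}I$$ for all closed $\mathcal F\subset Y$ and all open $\mathcal G\subset Y$. **Theorem.** Suppose that (H1) and (H2') hold, and let $\beta_N>0$ be real numbers tending to $\beta\in\,]0,\infty]$. If $\beta=\infty$, suppose in addition that (H3) holds. Then the measures $(\delta_N)_*\big(e^{-\beta_NH^{(N)}}\mu_0^{\otimes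 N}\big)$ on $\mathcal P(X)$ satisfy an LDP with speed $\beta_NN$ and rate functional $$F_\beta(\mu)=E(\mu)+\frac1\beta D_{\mu_0}(\mu)\qquad(F_\infty:=E).$$ Moreover, with $Z_N=\int_{X^N}e^{-\beta_NH^{(N)}}d\mu_0^{\otimes N}$, for all large $N$ the Gibbs measure $\mu^{(N)}_{\beta_N}=Z_N^{-1}e^{-\beta_NH^{(N)}}\mu_0^{\otimes N}$ is a well-defined probability measure, and the laws $(\delta_N)_*\mu^{(N)}_{\beta_N}$ satisfy an LDP with speed $\beta_NN$ and rate functional $F_\beta-\inf_{\mathcal P(X)}F_\beta$. -/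

import Mathlib

open MeasureTheory Filter Topology
open scoped ENNReal

namespace GibbsLDP

noncomputable section

/-- The empirical measure `δ_N(x₁,…,x_N) = (1/N) ∑ᵢ δ_{xᵢ}` as a probability measure on `X`.
For `N = 0`, where there is no such measure, an arbitrary Dirac mass is returned; all statements
below concern only the limit `N → ∞`. -/
def empiricalMeasure {X : Type*} [MeasurableSpace X] [Nonempty X] (N : ℕ) (x : Fin N → X) :
    ProbabilityMeasure X :=
  if h : N = 0 then ⟨Measure.dirac (Classical.arbitrary X), inferInstance⟩
  else ⟨(N : ℝ≥0∞)⁻¹ • ∑ i : Fin N, Measure.dirac (x i), ⟨by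
    have h0 : (N : ℝ≥0∞) ≠ 0 := by exact_mod_cast h
    simp [ENNReal.inv_mul_cancel h0 (ENNReal.natCast_ne_top N)]⟩⟩

/-- The product measure `μ^{⊗N}` on `X^N`. -/
def powMeasure {X : Type*} [MeasurableSpace X] (N : ℕ) (μ : ProbabilityMeasure X) :
    Measure (Fin N → X) :=
  Measure.pi fun _ : Fin N => (μ : Measure X)

/-- The integral `∫ f dν = ∫ f⁺ dν - ∫ f⁻ dν` of an extended real valued function. If both parts
are infinite the value is `⊥`, so a value in `ℝ` means that `f⁺` and `f⁻` have finite integrals. -/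
def extIntegral {Ω : Type*} [MeasurableSpace Ω] (ν : Measure Ω) (f : Ω → EReal) : EReal :=
  ((∫⁻ x, (f x).toENNReal ∂ν : ℝ≥0∞) : EReal) - ((∫⁻ x, (-f x).toENNReal ∂ν : ℝ≥0∞) : EReal)

/-- The mean energy `E^{(N)}(ν) = (1/N) ∫_{X^N} H^{(N)} dν`. -/
def meanEnergy {X : Type*} [MeasurableSpace X] (H : (N : ℕ) → (Fin N → X) → EReal) (N : ℕ)
    (ν : Measure (Fin N → X)) : EReal :=
  extIntegral ν (H N) / (N : EReal)

/-- (H1), existence of the macroscopic mean energy: `E` takes values in `]-∞,∞]`, `E(μ₀) < ∞`, and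
`E^{(N)}(μ^{⊗N}) → E(μ)` whenever `E(μ) < ∞`. That the integral of `H^{(N)}` against `μ^{⊗N}` makes
sense for large `N` is part of the condition. -/
structure HypH1 {X : Type*} [MeasurableSpace X]
    (μ₀ : ProbabilityMeasure X) (H : (N : ℕ) → (Fin N → X) → EReal)
    (E : ProbabilityMeasure X → EReal) : Prop where
  ne_bot : ∀ μ, E μ ≠ ⊥
  aemeasurable : ∀ μ, E μ < ⊤ → ∀ᶠ N in atTop, AEMeasurable (H N) (powMeasure N μ)
  tendsto : ∀ μ, E μ < ⊤ → Tendsto (fun N => meanEnergy H N (powMeasure N μ)) atTop (𝓝 (E μ))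
  reference_lt_top : E μ₀ < ⊤

/-- (H2'), the liminf inequality of Gamma-convergence: `liminf H^{(N)}(x^{(N)})/N ≥ E(μ)` for every
sequence of configurations whose empirical measures converge weakly to `μ`. -/
def HypH2' {X : Type*} [TopologicalSpace X] [MeasurableSpace X] [OpensMeasurableSpace X]
    [Nonempty X] (H : (N : ℕ) → (Fin N → X) → EReal) (E : ProbabilityMeasure X → EReal) : Prop :=
  ∀ (x : (N : ℕ) → Fin N → X) (μ : ProbabilityMeasure X),
    Tendsto (fun N => empiricalMeasure N (x N)) atTop (𝓝 μ) →
      E μ ≤ liminf (fun N => H N (x N) / (N : EReal)) atTop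

/-- (H3), the approximation property: every `μ` of finite energy is the weak limit of measures
which are absolutely continuous with respect to `μ₀`, of finite relative entropy, and whose energies
converge to that of `μ`. -/
def HypH3 {X : Type*} [TopologicalSpace X] [MeasurableSpace X] [OpensMeasurableSpace X]
    (μ₀ : ProbabilityMeasure X) (E : ProbabilityMeasure X → EReal) : Prop :=
  ∀ μ : ProbabilityMeasure X, E μ < ⊤ → ∃ ν : ℕ → ProbabilityMeasure X,
    Tendsto ν atTop (𝓝 μ) ∧
    (∀ j, (ν j : Measure X) ≪ (μ₀ : Measure X) ∧
      InformationTheory.klDiv (ν j : Measure X) (μ₀ : Measure X) < ⊤) ∧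
    Tendsto (fun j => E (ν j)) atTop (𝓝 (E μ))

/-- The free energy `F_β = E + (1/β) D_{μ₀}`, where `D_{μ₀}` is the relative entropy. In `EReal` one
has `a / ⊤ = 0` for all `a` (also `⊤ / ⊤ = 0`), so `F_∞ = E`. -/
def freeEnergy {X : Type*} [MeasurableSpace X] (μ₀ : ProbabilityMeasure X)
    (E : ProbabilityMeasure X → EReal) (β : EReal) (μ : ProbabilityMeasure X) : EReal :=
  E μ + ((InformationTheory.klDiv (μ : Measure X) (μ₀ : Measure X) : ℝ≥0∞) : EReal) / β

/-- The measure `e^{-βH^{(N)}} μ₀^{⊗N}` on `X^N` (with `e^{-∞} = 0`). -/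
def boltzmannMeasure {X : Type*} [MeasurableSpace X] (μ₀ : ProbabilityMeasure X)
    (H : (N : ℕ) → (Fin N → X) → EReal) (β : ℝ) (N : ℕ) : Measure (Fin N → X) :=
  (powMeasure N μ₀).withDensity fun x => EReal.exp (-((β : EReal) * H N x))

/-- The partition function `Z_{N,β} = ∫ e^{-βH^{(N)}} dμ₀^{⊗N}`. -/
def partitionFunction {X : Type*} [MeasurableSpace X] (μ₀ : ProbabilityMeasure X)
    (H : (N : ℕ) → (Fin N → X) → EReal) (β : ℝ) (N : ℕ) : ℝ≥0∞ :=
  ∫⁻ x, EReal.exp (-((β : EReal) * H N x)) ∂(powMeasure N μ₀)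

/-- The Gibbs measure `e^{-βH^{(N)}} μ₀^{⊗N} / Z_{N,β}`. -/
def gibbsMeasure {X : Type*} [MeasurableSpace X] (μ₀ : ProbabilityMeasure X)
    (H : (N : ℕ) → (Fin N → X) → EReal) (β : ℝ) (N : ℕ) : Measure (Fin N → X) :=
  (partitionFunction μ₀ H β N)⁻¹ • boltzmannMeasure μ₀ H β N

/-- The push-forward `(δ_N)_* ν`, a Borel measure on `𝓟(X)` with its weak topology. -/
def empiricalLaw {X : Type*} [TopologicalSpace X] [MeasurableSpace X] [OpensMeasurableSpace X]
    [Nonempty X] (N : ℕ) (ν : Measure (Fin N → X)) :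
    @Measure (ProbabilityMeasure X) (borel (ProbabilityMeasure X)) :=
  @Measure.map _ _ _ (borel (ProbabilityMeasure X)) (empiricalMeasure N) ν

/-- A sequence of Borel measures `Γ_N` on `Y` satisfies a large deviation principle with speed `r_N`
and rate function `I`: the function `I : Y → ]-∞,∞]` is lower semicontinuous, and the upper bound on
closed sets and the lower bound on open sets hold (with `log 0 = -∞`, `log ∞ = ∞`). -/
structure SatisfiesLDP {Y : Type*} [TopologicalSpace Y] (Γ : ℕ → @Measure Y (borel Y))
    (r : ℕ → ℝ) (I : Y → EReal) : Prop where
  ne_bot : ∀ y, I y ≠ ⊥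
  lowerSemicontinuous : LowerSemicontinuous I
  upper : ∀ F : Set Y, IsClosed F →
    limsup (fun N => ENNReal.log (Γ N F) / (r N : EReal)) atTop ≤ -⨅ y ∈ F, I y
  lower : ∀ G : Set Y, IsOpen G →
    -⨅ y ∈ G, I y ≤ liminf (fun N => ENNReal.log (Γ N G) / (r N : EReal)) atTop

end

end GibbsLDP

/-! Heuristically, the configurations with empirical measure near `μ` have `μ₀^{⊗N}`-probability
about `exp (-N D(μ))` by Sanov's theorem and carry the weight `exp (-β_N N E(μ))`. The product is
`exp (-β_N N (E + D/β_N)(μ))`. Since `𝓟(X)` is compact, only local estimates are needed.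

Upper bound. The Donsker–Varadhan formula, combined with an exponential Markov inequality, bounds
the probability of a neighbourhood of `μ` (`exists_open_powMeasure_le`). (H2') is equivalent to a
bound on `H^{(N)}/N` that is uniform over configurations near `μ` (`HypH2'.exists_open`).
Multiplying the two and covering a closed set by finitely many neighbourhoods gives the claim.

Lower bound. For `μ` in the open set with finite energy and entropy, change measure from `μ₀^{⊗N}`
to `μ^{⊗N}`. By the law of large numbers the empirical measure lies in the open set with probability
tending to 1. A Jensen-type inequality (`ofReal_exp_le_setLIntegral`) then bounds the integral from
below by the exponential of minus the mean energy and the entropy, and (H1) identifies the limit. If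
`β < ∞`, infinite entropy makes the bound trivial. If `β = ∞`, (H3) replaces `μ` by measures of
finite entropy.

Gibbs measures. The bounds for the whole space give the limit of `log Z_N / (β_N N)`. It is finite
because `F_β` is lower semicontinuous on a compact space, never `-∞`, and finite at `μ₀`. Hence `0 <
Z_N < ∞` eventually, and dividing by `Z_N` shifts the rate. -/

namespace GibbsLDP
open InformationTheory

/-! ### Donsker–Varadhan duality and lower semicontinuity of the relative entropy -/

section DonskerVaradhan

lemma tangent_exp_nonneg {g t : ℝ} (h : 0 ≤ t * (g - Real.exp t)) :
    0 ≤ g * t - Real.exp t + 1 := by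
  have h1 : 0 ≤ 1 - Real.exp t + t * Real.exp t := by
    have h2 := Real.add_one_le_exp (-t)
    have h3 : Real.exp t * Real.exp (-t) = 1 := by rw [← Real.exp_add]; simp
    nlinarith [Real.exp_pos t]
  nlinarith

/-- The logarithm truncated at levels `-n` and `n`, with `log 0 = -∞`. -/
noncomputable def truncLog (n : ℕ) (g : ℝ) : ℝ :=
  if g = 0 then -n else max (-n) (min n (Real.log g))

lemma measurable_truncLog (n : ℕ) : Measurable (truncLog n) := by
  unfold truncLog
  exact Measurable.ite (measurableSet_singleton 0) measurable_const (by fun_prop)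

lemma abs_truncLog_le (n : ℕ) (g : ℝ) : |truncLog n g| ≤ n := by
  unfold truncLog
  have : (0 : ℝ) ≤ n := n.cast_nonneg
  split_ifs
  · simp
  · rw [abs_le]
    exact ⟨le_max_left _ _, max_le (by linarith) (min_le_left _ _)⟩

/-- For `g > 0` the truncation lies between `0` and `log g`, so the sign condition of
`tangent_exp_nonneg` holds. This positivity is what Fatou's lemma needs later. -/
lemma truncLog_nonneg {g : ℝ} (hg : 0 ≤ g) (n : ℕ) :
    0 ≤ g * truncLog n g - Real.exp (truncLog n g) + 1 := by
  have hn : (0 : ℝ) ≤ n := n.cast_nonneg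
  unfold truncLog
  split_ifs with h
  · simp [h, hn]
  · have hg' : 0 < g := lt_of_le_of_ne hg (Ne.symm h)
    apply tangent_exp_nonneg
    set l := Real.log g with hl
    have hgl : g = Real.exp l := (Real.exp_log hg').symm
    rw [hgl]
    rcases le_total 0 l with h0 | h0
    · have h1 : 0 ≤ max (-(n : ℝ)) (min n l) := le_max_of_le_right (le_min hn h0)
      have h2 : max (-(n : ℝ)) (min n l) ≤ l := max_le (by linarith) (min_le_right _ _)
      exact mul_nonneg h1 (sub_nonneg.2 (Real.exp_le_exp.2 h2))
    · have h1 : max (-(n : ℝ)) (min n l) ≤ 0 := max_le (by linarith) (min_le_of_right_le h0)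
      have h2 : l ≤ max (-(n : ℝ)) (min n l) := le_max_of_le_right (le_min (by linarith) le_rfl)
      exact mul_nonneg_of_nonpos_of_nonpos h1 (sub_nonpos.2 (Real.exp_le_exp.2 h2))

lemma tendsto_truncLog {g : ℝ} (hg : 0 ≤ g) :
    Tendsto (fun n => g * truncLog n g - Real.exp (truncLog n g) + 1) atTop (𝓝 (klFun g)) := by
  rcases hg.eq_or_lt with rfl | hg
  · simp only [truncLog, if_true, klFun_zero, zero_mul, zero_sub]
    have : Tendsto (fun n : ℕ => Real.exp (-(n : ℝ))) atTop (𝓝 0) :=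
      Real.tendsto_exp_neg_atTop_nhds_zero.comp tendsto_natCast_atTop_atTop
    simpa using this.neg.add_const 1
  · have h : ∀ᶠ n : ℕ in atTop, klFun g = g * truncLog n g - Real.exp (truncLog n g) + 1 := by
      filter_upwards [(tendsto_natCast_atTop_atTop (R := ℝ)).eventually_ge_atTop |Real.log g|]
        with n hn
      rw [abs_le] at hn
      rw [truncLog, if_neg hg.ne', min_eq_right hn.2, max_eq_right hn.1, Real.exp_log hg, klFun]
      ring
    exact tendsto_const_nhds.congr' h

variable {X : Type*} [MeasurableSpace X] {μ ν : Measure X}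
  [IsProbabilityMeasure μ] [IsProbabilityMeasure ν]

lemma integrable_of_abs_le {f : X → ℝ} (hf : Measurable f) {M : ℝ} (hM : ∀ x, |f x| ≤ M) :
    Integrable f μ :=
  Integrable.of_bound hf.aestronglyMeasurable M (ae_of_all _ hM)

lemma integrable_exp_of_abs_le {f : X → ℝ} (hf : Measurable f) {M : ℝ} (hM : ∀ x, |f x| ≤ M) :
    Integrable (fun x => Real.exp (f x)) μ :=
  Integrable.of_bound hf.exp.aestronglyMeasurable (Real.exp M) (ae_of_all _ fun x => by
    rw [Real.norm_eq_abs, Real.abs_exp]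
    exact Real.exp_le_exp.2 ((le_abs_self _).trans (hM x)))

/-- The optimal test function is `log (dμ/dν)`, which may be unbounded. Its truncations are
admissible, and Fatou's lemma shows that they exhaust the entropy. -/
lemma exists_measurable_lt_of_lt_klDiv {a : ℝ} (ha : (a : EReal) < (klDiv μ ν : EReal)) :
    ∃ f : X → ℝ, Measurable f ∧ (∃ M, ∀ x, |f x| ≤ M) ∧
      a < ∫ x, f x ∂μ - ∫ x, Real.exp (f x) ∂ν + 1 := by
  by_cases hac : μ ≪ ν
  · by_contra! hcon
    set g : X → ℝ := fun x => (μ.rnDeriv ν x).toReal with hg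
    have hgm : Measurable g := by fun_prop
    have hg0 : ∀ x, 0 ≤ g x := fun x => ENNReal.toReal_nonneg
    let f : ℕ → X → ℝ := fun n x => truncLog n (g x)
    have hfm : ∀ n, Measurable (f n) := fun n => (measurable_truncLog n).comp hgm
    have hfb : ∀ n x, |f n x| ≤ n := fun n x => abs_truncLog_le n _
    let F : ℕ → X → ℝ := fun n x => g x * f n x - Real.exp (f n x) + 1
    have hFm : ∀ n, Measurable (F n) := fun n =>
      ((hgm.mul (hfm n)).sub (hfm n).exp).add measurable_const
    have hgi : ∀ n, Integrable (fun x => g x * f n x) ν := fun n => by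
      have := (Measure.integrable_toReal_rnDeriv (μ := μ) (ν := ν)).bdd_mul
        (hfm n).aestronglyMeasurable (ae_of_all _ (hfb n))
      simpa [mul_comm] using this
    have hFi : ∀ n, Integrable (F n) ν := fun n =>
      ((hgi n).sub (integrable_exp_of_abs_le (hfm n) (hfb n))).add (integrable_const _)
    have hint : ∀ n, ∫ x, F n x ∂ν = ∫ x, f n x ∂μ - ∫ x, Real.exp (f n x) ∂ν + 1 := fun n => by
      have he := integrable_exp_of_abs_le (μ := ν) (hfm n) (hfb n)
      simp only [F]
      have hs : Integrable (fun x => g x * f n x - Real.exp (f n x)) ν := (hgi n).sub he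
      rw [integral_add hs (integrable_const _), integral_sub (hgi n) he,
        integral_const]
      simp only [hg, probReal_univ, smul_eq_mul, mul_one]
      congr 2
      simpa using integral_rnDeriv_smul (f := f n) hac
    have hle : klDiv μ ν ≤ ENNReal.ofReal a := by
      rw [klDiv_eq_lintegral_klFun_of_ac hac]
      calc ∫⁻ x, ENNReal.ofReal (klFun (g x)) ∂ν
          = ∫⁻ x, liminf (fun n => ENNReal.ofReal (F n x)) atTop ∂ν := by
            refine lintegral_congr fun x => ?_
            exact ((ENNReal.tendsto_ofReal (tendsto_truncLog (hg0 x))).liminf_eq).symm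
        _ ≤ liminf (fun n => ∫⁻ x, ENNReal.ofReal (F n x) ∂ν) atTop :=
            lintegral_liminf_le fun n => (hFm n).ennreal_ofReal
        _ ≤ liminf (fun _ : ℕ => ENNReal.ofReal a) atTop := by
            refine liminf_le_liminf (Eventually.of_forall fun n => ?_)
            rw [← ofReal_integral_eq_lintegral_ofReal (hFi n)
              (ae_of_all _ fun x => truncLog_nonneg (hg0 x) n)]
            refine ENNReal.ofReal_le_ofReal ?_
            exact (hint n).trans_le (hcon (f n) (hfm n) ⟨n, hfb n⟩)
        _ = ENNReal.ofReal a := liminf_const _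
    -- The zero test function gives `a ≥ 0`, so `ENNReal.ofReal a` loses nothing.
    have h0 : 0 ≤ a := by
      have := hcon (fun _ => 0) measurable_const ⟨0, by simp⟩
      simpa using this
    have h1 : ((klDiv μ ν : ℝ≥0∞) : EReal) ≤ ((ENNReal.ofReal a : ℝ≥0∞) : EReal) := by
      exact_mod_cast hle
    rw [EReal.coe_ennreal_ofReal, max_eq_left h0] at h1
    exact absurd ha (not_lt.2 h1)
  · obtain ⟨s, hs, hνs, hμs⟩ : ∃ s, MeasurableSet s ∧ ν s = 0 ∧ μ s ≠ 0 := by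
      by_contra! h
      exact hac (Measure.AbsolutelyContinuous.mk fun s hs h0 => h s hs h0)
    have hp : 0 < μ.real s := ENNReal.toReal_pos hμs (measure_ne_top _ _)
    -- A multiple of the indicator of a `ν`-null set costs nothing under `ν`; this `t` makes its
    -- `μ`-integral `|a| + 1`.
    set t : ℝ := (|a| + 1) / μ.real s
    refine ⟨s.indicator fun _ => t, measurable_const.indicator hs, ⟨|t|, fun x => ?_⟩, ?_⟩
    · by_cases hx : x ∈ s <;> simp [hx]
    · have h1 : ∫ x, Real.exp (s.indicator (fun _ => t) x) ∂ν = 1 := by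
        have : (fun x => Real.exp (s.indicator (fun _ => t) x)) =ᵐ[ν] fun _ => 1 := by
          filter_upwards [measure_eq_zero_iff_ae_notMem.1 hνs] with x hx
          simp [hx]
        rw [integral_congr_ae this]; simp
      rw [h1, integral_indicator_const _ hs, smul_eq_mul, mul_div_cancel₀ _ hp.ne']
      have := le_abs_self a
      linarith

variable [TopologicalSpace X] [CompactSpace X] [TopologicalSpace.MetrizableSpace X] [BorelSpace X]

lemma integrable_continuousMap (f : C(X, ℝ)) : Integrable f μ :=
  f.continuous.integrable_of_hasCompactSupport (HasCompactSupport.of_compactSpace f)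

lemma integrable_exp_continuousMap (f : C(X, ℝ)) : Integrable (fun x => Real.exp (f x)) μ :=
  integrable_continuousMap ⟨fun x => Real.exp (f x), by fun_prop⟩

/-- Continuous functions are dense in `L¹(μ + ν)`. Clamping the approximant to `[-M, M]` does not
increase the error, and there `exp` is Lipschitz with constant `e^M`. -/
lemma exists_continuousMap_exp_sub_le {f : X → ℝ} (hf : Measurable f) {M : ℝ}
    (hM : ∀ x, |f x| ≤ M) {ε : ℝ} (hε : 0 < ε) :
    ∃ g : C(X, ℝ), ∫ x, f x ∂μ - ∫ x, Real.exp (f x) ∂ν - ε ≤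
      ∫ x, g x ∂μ - ∫ x, Real.exp (g x) ∂ν := by
  -- The `L¹` error enters with factor `1` under `μ` and `e^M` under `ν`.
  set δ : ℝ := ε / (1 + Real.exp M)
  have hδ : 0 < δ := by positivity
  obtain ⟨g₀, hg₀, hg₀i⟩ :=
    (integrable_of_abs_le (μ := μ) hf hM |>.add_measure
      (integrable_of_abs_le (μ := ν) hf hM)).exists_boundedContinuous_integral_sub_le hδ
  let g : C(X, ℝ) := ⟨fun x => max (-M) (min M (g₀ x)), by fun_prop⟩
  have hM0 : 0 ≤ M := (abs_nonneg _).trans (hM (Classical.choice μ.nonempty_of_neZero))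
  have hgM : ∀ x, |g x| ≤ M := fun x =>
    abs_le.2 ⟨le_max_left _ _, max_le (by linarith) (min_le_left _ _)⟩
  have hfg : ∀ x, |f x - g x| ≤ ‖f x - g₀ x‖ := fun x => by
    have h1 : f x = max (-M) (min M (f x)) := by
      rw [min_eq_right (abs_le.1 (hM x)).2, max_eq_right (abs_le.1 (hM x)).1]
    have h2 : |max (-M) (min M (f x)) - max (-M) (min M (g₀ x))| ≤ |f x - g₀ x| := by
      rw [max_comm (-M), max_comm (-M), min_comm M, min_comm M]
      exact (abs_max_sub_max_le_abs _ _ _).trans (abs_inf_sub_inf_le_abs _ _ _)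
    rwa [← h1] at h2
  have hfμ : Integrable f μ := integrable_of_abs_le hf hM
  have hfν : Integrable f ν := integrable_of_abs_le hf hM
  have hgμ : Integrable g μ := integrable_continuousMap g
  have hgν : Integrable g ν := integrable_continuousMap g
  have hdμ : Integrable (fun x => ‖f x - g₀ x‖) μ := 
    (hfμ.sub (hg₀i.mono_measure (Measure.le_add_right le_rfl))).norm
  have hdν : Integrable (fun x => ‖f x - g₀ x‖) ν := 
    (hfν.sub (hg₀i.mono_measure (Measure.le_add_left le_rfl))).norm
  rw [integral_add_measure hdμ hdν] at hg₀
  have p1 : 0 ≤ ∫ x, ‖f x - g₀ x‖ ∂μ := integral_nonneg fun x => norm_nonneg _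
  have p2 : 0 ≤ ∫ x, ‖f x - g₀ x‖ ∂ν := integral_nonneg fun x => norm_nonneg _
  have k1 : ∫ x, f x ∂μ - ∫ x, g x ∂μ ≤ ∫ x, ‖f x - g₀ x‖ ∂μ := by
    rw [← integral_sub hfμ hgμ]
    exact integral_mono (hfμ.sub hgμ) hdμ fun x => (le_abs_self _).trans (hfg x)
  have k2 : ∫ x, Real.exp (g x) ∂ν - ∫ x, Real.exp (f x) ∂ν ≤
      Real.exp M * ∫ x, ‖f x - g₀ x‖ ∂ν := by
    rw [← integral_sub (integrable_exp_continuousMap g) (integrable_exp_of_abs_le hf hM),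
      ← integral_const_mul]
    refine integral_mono ((integrable_exp_continuousMap g).sub (integrable_exp_of_abs_le hf hM))
      (hdν.const_mul _) fun x => ?_
    have e1 := Real.add_one_le_exp (f x - g x)
    have e2 : Real.exp (g x) * Real.exp (f x - g x) = Real.exp (f x) := by
      rw [← Real.exp_add]; congr 1; ring
    have e3 : Real.exp (g x) ≤ Real.exp M :=
      Real.exp_le_exp.2 ((le_abs_self _).trans (hgM x))
    have e4 := hfg x
    have e5 := neg_abs_le (f x - g x)
    have e6 := Real.exp_pos (g x)
    have e7 : Real.exp (g x) * |f x - g x| ≤ Real.exp M * ‖f x - g₀ x‖ :=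
      mul_le_mul e3 e4 (abs_nonneg _) (Real.exp_pos _).le
    show Real.exp (g x) - Real.exp (f x) ≤ Real.exp M * ‖f x - g₀ x‖
    nlinarith
  refine ⟨g, ?_⟩
  have k3 : ∫ x, ‖f x - g₀ x‖ ∂μ + Real.exp M * ∫ x, ‖f x - g₀ x‖ ∂ν ≤ ε := by
    have : δ * (1 + Real.exp M) = ε := div_mul_cancel₀ _ (by positivity)
    nlinarith [Real.exp_pos M]
  linarith

/-- The Donsker–Varadhan lower bound for the relative entropy by continuous test functions. -/
lemma exists_continuousMap_lt_of_lt_klDiv {a : ℝ} (ha : (a : EReal) < (klDiv μ ν : EReal)) :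
    ∃ f : C(X, ℝ), a < ∫ x, f x ∂μ - Real.log (∫ x, Real.exp (f x) ∂ν) := by
  obtain ⟨f, hf, ⟨M, hM⟩, h⟩ := exists_measurable_lt_of_lt_klDiv ha
  obtain ⟨g, hg⟩ := exists_continuousMap_exp_sub_le (μ := μ) (ν := ν) hf hM
    (half_pos (sub_pos.2 h))
  refine ⟨g, ?_⟩
  have hpos : 0 < ∫ x, Real.exp (g x) ∂ν := integral_exp_pos (integrable_exp_continuousMap g)
  have := Real.log_le_sub_one_of_pos hpos
  linarith

/-- After subtracting `c` the test function has exponential integral `1`, and the claim is the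
integrated Young inequality `g t - e^t + 1 ≤ klFun g` with `g = dμ/dν` and `t = f - c`. -/
lemma integral_sub_log_le_klDiv (f : C(X, ℝ)) :
    ((∫ x, f x ∂μ - Real.log (∫ x, Real.exp (f x) ∂ν) : ℝ) : EReal) ≤ (klDiv μ ν : EReal) := by
  by_cases hkl : klDiv μ ν = ∞
  · simp [hkl]
  obtain ⟨hac, hllr⟩ := klDiv_ne_top_iff.1 hkl
  have hpos : 0 < ∫ x, Real.exp (f x) ∂ν := integral_exp_pos (integrable_exp_continuousMap f)
  set c := Real.log (∫ x, Real.exp (f x) ∂ν) with hc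
  rw [← EReal.coe_ennreal_toReal hkl, EReal.coe_le_coe_iff,
    toReal_klDiv_eq_integral_klFun hac]
  have hgi : Integrable (fun x => (μ.rnDeriv ν x).toReal * (f x - c)) ν := by
    have : Integrable (fun x => f x - c) μ := (integrable_continuousMap f).sub (integrable_const c)
    simpa using (integrable_rnDeriv_smul_iff hac).2 this
  have he : Integrable (fun x => Real.exp (f x - c)) ν :=
    integrable_exp_continuousMap ⟨fun x => f x - c, by fun_prop⟩
  have h1 : ∫ x, f x ∂μ - c =
      ∫ x, ((μ.rnDeriv ν x).toReal * (f x - c) - Real.exp (f x - c) + 1) ∂ν := by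
    have hs : Integrable (fun x => (μ.rnDeriv ν x).toReal * (f x - c) - Real.exp (f x - c)) ν :=
      hgi.sub he
    rw [integral_add hs (integrable_const _), integral_sub hgi he]
    have e1 : ∫ x, (μ.rnDeriv ν x).toReal * (f x - c) ∂ν = ∫ x, (f x - c) ∂μ := by
      simpa using integral_rnDeriv_smul (f := fun x => f x - c) hac
    have e2 : ∫ x, Real.exp (f x - c) ∂ν = 1 := by
      simp only [Real.exp_sub]
      rw [integral_div, hc, Real.exp_log hpos, div_self hpos.ne']
    rw [e1, e2, integral_sub (integrable_continuousMap f) (integrable_const c)]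
    simp
  rw [h1]
  refine integral_mono ((hgi.sub he).add (integrable_const _))
    ((integrable_klFun_rnDeriv_iff hac).2 hllr) fun x => ?_
  have hg0 : 0 ≤ (μ.rnDeriv ν x).toReal := ENNReal.toReal_nonneg
  generalize (μ.rnDeriv ν x).toReal = g at hg0
  generalize f x - c = t
  simp only [klFun]
  rcases hg0.eq_or_lt with rfl | hg
  · simp [Real.exp_pos t |>.le]
  · have h2 := Real.add_one_le_exp (t - Real.log g)
    have h3 : g * Real.exp (t - Real.log g) = Real.exp t := by
      rw [Real.exp_sub, Real.exp_log hg]; field_simp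
    nlinarith

end DonskerVaradhan

/-- By duality the entropy is a supremum of weakly continuous functions of `μ`. -/
lemma lowerSemicontinuous_klDiv {X : Type*} [TopologicalSpace X] [CompactSpace X]
    [TopologicalSpace.MetrizableSpace X] [MeasurableSpace X] [BorelSpace X]
    (μ₀ : ProbabilityMeasure X) :
    LowerSemicontinuous fun μ : ProbabilityMeasure X =>
      (klDiv (μ : Measure X) (μ₀ : Measure X) : EReal) := by
  intro μ y hy
  obtain ⟨a, hya, ha⟩ := EReal.lt_iff_exists_real_btwn.1 hy
  obtain ⟨f, hf⟩ := exists_continuousMap_lt_of_lt_klDiv ha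
  have hcont : Continuous fun ν : ProbabilityMeasure X =>
      ∫ x, f x ∂(ν : Measure X) - Real.log (∫ x, Real.exp (f x) ∂(μ₀ : Measure X)) :=
    (ProbabilityMeasure.continuous_integral_continuousMap f).sub continuous_const
  filter_upwards [hcont.continuousAt.eventually (lt_mem_nhds hf)] with ν hν
  exact hya.trans_le ((EReal.coe_le_coe_iff.2 (le_of_lt hν)).trans (integral_sub_log_le_klDiv f))

lemma measurableSet_borel_of_isOpen {Y : Type*} [TopologicalSpace Y] {s : Set Y} (hs : IsOpen s) :
    @MeasurableSet _ (borel Y) s :=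
  MeasurableSpace.measurableSet_generateFrom hs

/-! ### Empirical measures: local Sanov bound and law of large numbers -/

section Empirical

variable {X : Type*} [MeasurableSpace X]

instance (N : ℕ) (μ : ProbabilityMeasure X) : IsProbabilityMeasure (powMeasure N μ) :=
  inferInstanceAs (IsProbabilityMeasure (Measure.pi fun _ : Fin N => (μ : Measure X)))

variable [TopologicalSpace X] [CompactSpace X] [TopologicalSpace.MetrizableSpace X] [BorelSpace X]
  [Nonempty X]

lemma integral_empiricalMeasure {N : ℕ} (hN : N ≠ 0) (x : Fin N → X) (f : C(X, ℝ)) :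
    ∫ y, f y ∂(empiricalMeasure N x : Measure X) = (N : ℝ)⁻¹ * ∑ i, f (x i) := by
  have h : (empiricalMeasure N x : Measure X) = (N : ℝ≥0∞)⁻¹ • ∑ i : Fin N, Measure.dirac (x i) := by
    simp [empiricalMeasure, hN]
  rw [h, integral_smul_measure, integral_finsetSum_measure fun i _ => integrable_continuousMap f]
  simp

lemma continuous_empiricalMeasure (N : ℕ) :
    Continuous (empiricalMeasure N : (Fin N → X) → ProbabilityMeasure X) := by
  rcases eq_or_ne N 0 with rfl | hN
  · exact continuous_of_const fun x y => by rw [Subsingleton.elim x y]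
  · rw [ProbabilityMeasure.continuous_iff_forall_continuousMap_continuous_integral]
    intro f
    simp only [integral_empiricalMeasure hN]
    fun_prop

lemma measurableSet_empiricalMeasure_mem (N : ℕ) {s : Set (ProbabilityMeasure X)}
    (hs : @MeasurableSet _ (borel _) s) :
    MeasurableSet {x : Fin N → X | empiricalMeasure N x ∈ s} := by
  let _ : MeasurableSpace (ProbabilityMeasure X) := borel _
  have : BorelSpace (ProbabilityMeasure X) := ⟨rfl⟩
  exact (continuous_empiricalMeasure N).measurable hs

lemma empiricalLaw_apply (N : ℕ) (ν : Measure (Fin N → X)) {s : Set (ProbabilityMeasure X)}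
    (hs : @MeasurableSet _ (borel _) s) :
    empiricalLaw N ν s = ν {x | empiricalMeasure N x ∈ s} := by
  let _ : MeasurableSpace (ProbabilityMeasure X) := borel _
  have : BorelSpace (ProbabilityMeasure X) := ⟨rfl⟩
  exact Measure.map_apply (continuous_empiricalMeasure N).measurable hs

/-- The local upper bound in Sanov's theorem. -/
lemma exists_open_powMeasure_le {μ ν : ProbabilityMeasure X} {a : ℝ}
    (ha : (a : EReal) < (klDiv (ν : Measure X) (μ : Measure X) : EReal)) :
    ∃ U : Set (ProbabilityMeasure X), IsOpen U ∧ ν ∈ U ∧ ∀ N : ℕ, N ≠ 0 →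
      powMeasure N μ {x | empiricalMeasure N x ∈ U} ≤ ENNReal.ofReal (Real.exp (-(N * a))) := by
  obtain ⟨f, hf⟩ := exists_continuousMap_lt_of_lt_klDiv ha
  have hpos : 0 < ∫ x, Real.exp (f x) ∂(μ : Measure X) :=
    integral_exp_pos (integrable_exp_continuousMap f)
  set c := Real.log (∫ x, Real.exp (f x) ∂(μ : Measure X)) with hc
  refine ⟨{ρ | a + c < ∫ x, f x ∂(ρ : Measure X)},
    isOpen_lt continuous_const (ProbabilityMeasure.continuous_integral_continuousMap f),
    by simp only [Set.mem_ofPred_eq]; linarith, fun N hN => ?_⟩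
  have hN' : (0 : ℝ) < N := by exact_mod_cast Nat.pos_of_ne_zero hN
  set S := {x : Fin N → X | empiricalMeasure N x ∈
    {ρ : ProbabilityMeasure X | a + c < ∫ x, f x ∂(ρ : Measure X)}} with hS
  have hcont : Continuous fun x : Fin N → X =>
      Real.exp (-(N * (a + c))) * ∏ i, Real.exp (f (x i)) := by fun_prop
  have hval : ∫ x : Fin N → X, Real.exp (-(N * (a + c))) * ∏ i, Real.exp (f (x i))
      ∂(powMeasure N μ) = Real.exp (-(N * a)) := by
    rw [integral_const_mul, powMeasure,
      integral_fintype_prod_eq_pow (fun x => Real.exp (f x)), ← Real.exp_log hpos, ← hc,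
      ← Real.exp_nat_mul, ← Real.exp_add, Fintype.card_fin]
    congr 1; ring
  have hint : Integrable (fun x : Fin N → X =>
      Real.exp (-(N * (a + c))) * ∏ i, Real.exp (f (x i))) (powMeasure N μ) :=
    integrable_continuousMap ⟨_, hcont⟩
  -- Markov's inequality: on `S` the function `exp (∑ f(xᵢ) - N (a + c))` is at least `1`, and by
  -- independence its integral is `exp (-N a)`.
  calc powMeasure N μ S ≤ ∫⁻ x, ENNReal.ofReal
        (Real.exp (-(N * (a + c))) * ∏ i, Real.exp (f (x i))) ∂(powMeasure N μ) := by
        refine (measure_mono fun x hx => ?_).trans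
          ((one_mul _).symm.le.trans (mul_meas_ge_le_lintegral₀
            hcont.measurable.ennreal_ofReal.aemeasurable 1))
        simp only [hS, Set.mem_ofPred_eq, integral_empiricalMeasure hN] at hx ⊢
        rw [← Real.exp_sum, ← Real.exp_add, ENNReal.one_le_ofReal, Real.one_le_exp_iff]
        rw [lt_inv_mul_iff₀ hN'] at hx
        linarith
    _ = ENNReal.ofReal (Real.exp (-(N * a))) := by
        rw [← ofReal_integral_eq_lintegral_ofReal hint (ae_of_all _ fun x => by positivity), hval]

/-- The weak law of large numbers for empirical measures. -/
lemma tendsto_powMeasure_empiricalMeasure_notMem (μ : ProbabilityMeasure X)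
    {U : Set (ProbabilityMeasure X)} (hU : U ∈ 𝓝 μ) :
    Tendsto (fun N => powMeasure N μ {x | empiricalMeasure N x ∉ U}) atTop (𝓝 0) := by
  obtain ⟨V, hVU, hV, hμV⟩ := mem_nhds_iff.1 hU
  suffices h : Tendsto (fun N => powMeasure N μ {x | empiricalMeasure N x ∈ Vᶜ}) atTop (𝓝 0) from
    tendsto_of_tendsto_of_tendsto_of_le_of_le tendsto_const_nhds h (fun _ => zero_le)
      fun N => measure_mono fun x hx => fun h => hx (hVU h)
  -- The complement of `V` is compact, and each of its points has positive entropy relative to `μ`,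
  -- hence a neighbourhood of exponentially small probability.
  refine hV.isClosed_compl.isCompact.induction_on (p := fun s =>
    Tendsto (fun N => powMeasure N μ {x | empiricalMeasure N x ∈ s}) atTop (𝓝 0)) ?_ ?_ ?_ ?_
  · simp
  · exact fun s t hst ht => tendsto_of_tendsto_of_tendsto_of_le_of_le tendsto_const_nhds ht
      (fun _ => zero_le) fun N => measure_mono fun x hx => hst hx
  · intro s t hs ht
    refine tendsto_of_tendsto_of_tendsto_of_le_of_le tendsto_const_nhds
      (by simpa using hs.add ht) (fun _ => zero_le) fun N => ?_
    exact measure_union_le {x | empiricalMeasure N x ∈ s} {x | empiricalMeasure N x ∈ t}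
  · intro ν hν
    have hne : klDiv (ν : Measure X) (μ : Measure X) ≠ 0 := fun h =>
      hν ((Subtype.ext ((klDiv_eq_zero_iff (μ := (ν : Measure X)) (ν := (μ : Measure X))).1 h) : ν = μ) ▸ hμV)
    have hlt : ((0 : ℝ) : EReal) < (klDiv (ν : Measure X) (μ : Measure X) : EReal) := by
      rw [EReal.coe_zero]
      exact EReal.coe_ennreal_pos.2 (pos_iff_ne_zero.2 hne)
    obtain ⟨a, ha0, ha⟩ := EReal.lt_iff_exists_real_btwn.1 hlt
    obtain ⟨W, hW, hνW, hle⟩ := exists_open_powMeasure_le ha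
    refine ⟨W, mem_nhdsWithin_of_mem_nhds (hW.mem_nhds hνW), ?_⟩
    have ha0' : 0 < a := EReal.coe_lt_coe_iff.1 ha0
    have hlim : Tendsto (fun N : ℕ => ENNReal.ofReal (Real.exp (-(N * a)))) atTop (𝓝 0) := by
      rw [← ENNReal.ofReal_zero]
      refine ENNReal.tendsto_ofReal (Real.tendsto_exp_neg_atTop_nhds_zero.comp ?_)
      exact tendsto_natCast_atTop_atTop.atTop_mul_const ha0'
    refine tendsto_of_tendsto_of_tendsto_of_le_of_le' tendsto_const_nhds hlim
      (Eventually.of_forall fun _ => zero_le) ?_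
    filter_upwards [eventually_ne_atTop 0] with N hN using hle N hN

lemma eventually_exists_empiricalMeasure_mem (μ : ProbabilityMeasure X)
    {U : Set (ProbabilityMeasure X)} (hU : U ∈ 𝓝 μ) :
    ∀ᶠ N in atTop, ∃ x : Fin N → X, empiricalMeasure N x ∈ U := by
  filter_upwards [(tendsto_powMeasure_empiricalMeasure_notMem μ hU).eventually
    (gt_mem_nhds one_pos)] with N hN
  by_contra! h
  simp [h] at hN

/-- Every probability measure is a weak limit of empirical measures. -/
lemma exists_tendsto_empiricalMeasure (μ : ProbabilityMeasure X) :
    ∃ x : (N : ℕ) → Fin N → X, Tendsto (fun N => empiricalMeasure N (x N)) atTop (𝓝 μ) := by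
  let _ : MetricSpace (ProbabilityMeasure X) := TopologicalSpace.metrizableSpaceMetric _
  -- A configuration closest to `μ` works: its distance is below `ε` as soon as some configuration
  -- is that close.
  have hmin : ∀ N, ∃ x : Fin N → X, ∀ y,
      dist (empiricalMeasure N x) μ ≤ dist (empiricalMeasure N y) μ := fun N => by
    obtain ⟨x, -, hx⟩ := isCompact_univ.exists_isMinOn Set.univ_nonempty
      ((continuous_empiricalMeasure (X := X) N).dist (continuous_const (y := μ))).continuousOn
    exact ⟨x, fun y => hx (Set.mem_univ y)⟩
  choose x hx using hmin
  refine ⟨x, Metric.tendsto_nhds.2 fun ε hε => ?_⟩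
  filter_upwards [eventually_exists_empiricalMeasure_mem μ (Metric.ball_mem_nhds μ hε)]
    with N ⟨y, hy⟩
  exact (hx N y).trans_lt hy

end Empirical

/-- A real value excludes infinite positive or negative parts, because `⊤ - ⊤ = ⊥` in `EReal`. This
passes from extended integrals to Bochner integrals. -/
lemma extIntegral_eq_coe {Ω : Type*} [MeasurableSpace Ω] {ν : Measure Ω} {f : Ω → EReal}
    (hf : AEMeasurable f ν) {r : ℝ} (h : extIntegral ν f = r) :
    Integrable (fun x => (f x).toReal) ν ∧ (∀ᵐ x ∂ν, ((f x).toReal : EReal) = f x) ∧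
      ∫ x, (f x).toReal ∂ν = r := by
  unfold extIntegral at h
  set P := ∫⁻ x, (f x).toENNReal ∂ν with hP
  set Q := ∫⁻ x, (-f x).toENNReal ∂ν with hQ
  have hQt : Q ≠ ∞ := by
    intro hQt
    rw [hQt, EReal.coe_ennreal_top, EReal.sub_top] at h
    exact EReal.coe_ne_bot r h.symm
  have hPt : P ≠ ∞ := by
    intro hPt
    rw [hPt, ← EReal.coe_ennreal_toReal hQt, EReal.coe_ennreal_top, EReal.top_sub_coe] at h
    exact EReal.coe_ne_top r h.symm
  have hmP : AEMeasurable (fun x => (f x).toENNReal) ν := hf.ereal_toENNReal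
  have hmQ : AEMeasurable (fun x => (-f x).toENNReal) ν :=
    ((continuous_neg (G := EReal)).measurable.comp_aemeasurable hf).ereal_toENNReal
  have hae : ∀ᵐ x ∂ν, ((f x).toReal : EReal) = f x := by
    filter_upwards [ae_lt_top' hmP hPt, ae_lt_top' hmQ hQt] with x h1 h2
    refine EReal.coe_toReal (fun h => ?_) (fun h => ?_)
    · simp [h] at h1
    · simp [h] at h2
  have e1 : ∫⁻ x, ENNReal.ofReal (f x).toReal ∂ν = P := by
    refine lintegral_congr_ae ?_
    filter_upwards [hae] with x hx
    conv_rhs => rw [← hx]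
    simp
  have e2 : ∫⁻ x, ENNReal.ofReal (-(f x).toReal) ∂ν = Q := by
    refine lintegral_congr_ae ?_
    filter_upwards [hae] with x hx
    conv_rhs => rw [← hx]
    rw [← EReal.coe_neg]
    simp only [EReal.toENNReal_of_ne_top (EReal.coe_ne_top _), EReal.toReal_coe]
  have hm : AEMeasurable (fun x => (f x).toReal) ν := hf.ereal_toReal
  have hint : Integrable (fun x => (f x).toReal) ν := by
    refine ⟨hm.aestronglyMeasurable, ?_⟩
    rw [hasFiniteIntegral_iff_norm]
    calc ∫⁻ x, ENNReal.ofReal ‖(f x).toReal‖ ∂ν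
        ≤ ∫⁻ x, (ENNReal.ofReal (f x).toReal + ENNReal.ofReal (-(f x).toReal)) ∂ν := by
          refine lintegral_mono fun x => ?_
          rcases le_total 0 (f x).toReal with h0 | h0
          · rw [Real.norm_of_nonneg h0]; exact le_self_add
          · rw [Real.norm_of_nonpos h0]; exact le_add_self
      _ = P + Q := by rw [lintegral_add_left' hm.ennreal_ofReal, e1, e2]
      _ < ∞ := ENNReal.add_lt_top.2 ⟨hPt.lt_top, hQt.lt_top⟩
  refine ⟨hint, hae, ?_⟩
  rw [integral_eq_lintegral_pos_part_sub_lintegral_neg_part hint, e1, e2]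
  rw [← EReal.coe_ennreal_toReal hQt, ← EReal.coe_ennreal_toReal hPt, ← EReal.coe_sub] at h
  exact EReal.coe_injective h

/-! ### Consequences of (H1) and (H2') for the energy -/

section Energy

variable {X : Type*} [MeasurableSpace X] {μ₀ : ProbabilityMeasure X}
  {H : (N : ℕ) → (Fin N → X) → EReal} {E : ProbabilityMeasure X → EReal}

lemma HypH1.eventually_integrable (h1 : HypH1 μ₀ H E) {μ : ProbabilityMeasure X} (hμ : E μ < ⊤) :
    ∀ᶠ N in atTop, Integrable (fun x => (H N x).toReal) (powMeasure N μ) ∧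
      (∀ᵐ x ∂(powMeasure N μ), ((H N x).toReal : EReal) = H N x) ∧
      meanEnergy H N (powMeasure N μ) =
        (((∫ x, (H N x).toReal ∂(powMeasure N μ)) / N : ℝ) : EReal) := by
  have hb := (h1.tendsto μ hμ).eventually (lt_mem_nhds (bot_lt_iff_ne_bot.2 (h1.ne_bot μ)))
  have ht := (h1.tendsto μ hμ).eventually (gt_mem_nhds hμ)
  filter_upwards [hb, ht, h1.aemeasurable μ hμ, eventually_gt_atTop 0] with N hbN htN hm hN
  have hN0 : (0 : EReal) < (N : EReal) := by exact_mod_cast hN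
  have hNt : (N : EReal) ≠ ⊤ := EReal.natCast_ne_top N
  unfold meanEnergy at hbN htN ⊢
  have h2 : extIntegral (powMeasure N μ) (H N) ≠ ⊥ := fun h => by
    rw [h, EReal.bot_div_of_pos_ne_top hN0 hNt] at hbN
    exact lt_irrefl _ hbN
  have h3 : extIntegral (powMeasure N μ) (H N) ≠ ⊤ := fun h => by
    rw [h, EReal.top_div_of_pos_ne_top hN0 hNt] at htN
    exact lt_irrefl _ htN
  obtain ⟨i1, i2, i3⟩ := extIntegral_eq_coe hm (EReal.coe_toReal h3 h2).symm
  refine ⟨i1, i2, ?_⟩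
  rw [i3, EReal.coe_div, EReal.coe_toReal h3 h2]
  rfl

lemma HypH1.tendsto_integral (h1 : HypH1 μ₀ H E) {μ : ProbabilityMeasure X} (hμ : E μ < ⊤) :
    Tendsto (fun N : ℕ => (∫ x, (H N x).toReal ∂(powMeasure N μ)) / N) atTop
      (𝓝 (E μ).toReal) := by
  rw [← EReal.tendsto_coe, EReal.coe_toReal hμ.ne (h1.ne_bot μ)]
  refine (h1.tendsto μ hμ).congr' ?_
  filter_upwards [h1.eventually_integrable hμ] with N hN using hN.2.2

variable [TopologicalSpace X] [CompactSpace X] [TopologicalSpace.MetrizableSpace X] [BorelSpace X]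
  [Nonempty X]

/-- If this failed, shrinking balls around `μ` would contain empirical measures of low energy for
arbitrarily large `N`, giving a sequence that violates (H2'). -/
lemma HypH2'.exists_open (h2 : HypH2' H E) {μ : ProbabilityMeasure X} {a : EReal} (ha : a < E μ) :
    ∃ U, IsOpen U ∧ μ ∈ U ∧ ∀ᶠ N in atTop, ∀ x, empiricalMeasure N x ∈ U →
      a < H N x / (N : EReal) := by
  by_contra! hcon
  let _ : MetricSpace (ProbabilityMeasure X) := TopologicalSpace.metrizableSpaceMetric _
  have hfreq : ∀ k : ℕ, ∃ᶠ N in atTop, ∃ x : Fin N → X,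
      dist (empiricalMeasure N x) μ < 1 / ((k : ℝ) + 1) ∧ H N x / (N : EReal) ≤ a := fun k => by
    have hk : (0 : ℝ) < 1 / ((k : ℝ) + 1) := by positivity
    exact hcon (Metric.ball μ _) Metric.isOpen_ball (Metric.mem_ball_self hk)
  obtain ⟨φ, hφ, hφx⟩ := extraction_forall_of_frequently hfreq
  -- (H2') concerns full sequences, so the indices missed by `φ` are filled with configurations `y`
  -- whose empirical measures also converge to `μ`.
  obtain ⟨y, hy⟩ := exists_tendsto_empiricalMeasure μ
  have hx : ∀ N, ∃ x : Fin N → X, ∀ k, φ k = N →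
      dist (empiricalMeasure N x) μ < 1 / ((k : ℝ) + 1) ∧ H N x / (N : EReal) ≤ a := fun N => by
    by_cases hN : ∃ k, φ k = N
    · obtain ⟨k, rfl⟩ := hN
      obtain ⟨x, hx⟩ := hφx k
      exact ⟨x, fun j hj => hφ.injective hj ▸ hx⟩
    · exact ⟨y N, fun k hk => absurd ⟨k, hk⟩ hN⟩
  choose x₀ hx₀ using hx
  classical
  let x : (N : ℕ) → Fin N → X := fun N => if ∃ k, φ k = N then x₀ N else y N
  have hxt : Tendsto (fun N => empiricalMeasure N (x N)) atTop (𝓝 μ) := by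
    refine Metric.tendsto_nhds.2 fun ε hε => ?_
    obtain ⟨m, hm⟩ := exists_nat_one_div_lt hε
    filter_upwards [eventually_ge_atTop (φ m), Metric.tendsto_nhds.1 hy ε hε] with N hN hyN
    by_cases h : ∃ k, φ k = N
    · simp only [x, if_pos h]
      obtain ⟨k, hk⟩ := h
      have hmk : m ≤ k := hφ.le_iff_le.1 (hk ▸ hN)
      refine (hx₀ N k hk).1.trans_le (le_trans ?_ hm.le)
      exact one_div_le_one_div_of_le (by positivity) (by exact_mod_cast Nat.succ_le_succ hmk)
    · simpa only [x, if_neg h] using hyN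
  have hle : liminf (fun N => H N (x N) / (N : EReal)) atTop ≤ a := by
    refine liminf_le_of_frequently_le' (frequently_atTop.2 fun n => ⟨φ n, hφ.id_le n, ?_⟩)
    have h : ∃ k, φ k = φ n := ⟨n, rfl⟩
    simp only [x, if_pos h]
    exact (hx₀ _ n rfl).2
  exact absurd ha (not_lt.2 ((h2 x μ hxt).trans hle))

lemma coe_mul_le_of_lt_div {a : ℝ} {h : EReal} {N : ℕ} (hN : 0 < N)
    (hlt : (a : EReal) < h / (N : EReal)) : ((a * N : ℝ) : EReal) ≤ h := by
  have := (EReal.lt_div_iff (by exact_mod_cast hN) (EReal.natCast_ne_top N)).1 hlt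
  rw [EReal.coe_mul]
  exact_mod_cast this.le

/-- Local lower bounds on `H^{(N)}/N` become global by compactness of `𝓟(X)`. The bound controls the
energy on events of small probability. -/
lemma HypH2'.exists_le (h2 : HypH2' H E) (hE : ∀ μ, E μ ≠ ⊥) :
    ∃ c : ℝ, ∀ᶠ N : ℕ in atTop, ∀ x, ((c * N : ℝ) : EReal) ≤ H N x := by
  suffices h : ∃ c : ℝ, ∀ᶠ N : ℕ in atTop, ∀ x,
      empiricalMeasure N x ∈ (Set.univ : Set (ProbabilityMeasure X)) →
        ((c * N : ℝ) : EReal) ≤ H N x by simpa using h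
  refine isCompact_univ.induction_on (p := fun s => ∃ c : ℝ, ∀ᶠ N : ℕ in atTop, ∀ x,
    empiricalMeasure N x ∈ s → ((c * N : ℝ) : EReal) ≤ H N x) ⟨0, by simp⟩ ?_ ?_ ?_
  · rintro s t hst ⟨c, hc⟩
    exact ⟨c, hc.mono fun N hN x hx => hN x (hst hx)⟩
  · rintro s t ⟨c, hc⟩ ⟨d, hd⟩
    refine ⟨min c d, ?_⟩
    filter_upwards [hc, hd] with N hcN hdN x hx
    rcases hx with hx | hx
    · refine le_trans (EReal.coe_le_coe_iff.2 ?_) (hcN x hx)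
      exact mul_le_mul_of_nonneg_right (min_le_left _ _) N.cast_nonneg
    · refine le_trans (EReal.coe_le_coe_iff.2 ?_) (hdN x hx)
      exact mul_le_mul_of_nonneg_right (min_le_right _ _) N.cast_nonneg
  · intro μ _
    obtain ⟨a, -, ha⟩ := EReal.lt_iff_exists_real_btwn.1 (bot_lt_iff_ne_bot.2 (hE μ))
    obtain ⟨U, hU, hμU, h⟩ := h2.exists_open ha
    refine ⟨U, mem_nhdsWithin_of_mem_nhds (hU.mem_nhds hμU), a, ?_⟩
    filter_upwards [h, eventually_gt_atTop 0] with N hN hN0 x hx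
    exact coe_mul_le_of_lt_div hN0 (hN x hx)

/-- The energy is lower semicontinuous. -/
lemma HypH1.lowerSemicontinuous (h1 : HypH1 μ₀ H E) (h2 : HypH2' H E) :
    LowerSemicontinuous E := by
  intro μ y hy
  obtain ⟨a, hya, ha⟩ := EReal.lt_iff_exists_real_btwn.1 hy
  obtain ⟨U, hU, hμU, hUN⟩ := h2.exists_open ha
  obtain ⟨c, hc⟩ := h2.exists_le h1.ne_bot
  filter_upwards [hU.mem_nhds hμU] with ν hν
  refine hya.trans_le ?_
  rcases eq_or_ne (E ν) ⊤ with htop | htop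
  · simp [htop]
  have hνt : E ν < ⊤ := lt_top_iff_ne_top.2 htop
  rw [← EReal.coe_toReal htop (h1.ne_bot ν), EReal.coe_le_coe_iff]
  have hq : Tendsto (fun N => (powMeasure N ν).real {x | empiricalMeasure N x ∉ U}) atTop (𝓝 0) :=
    (ENNReal.tendsto_toReal ENNReal.zero_ne_top).comp
      (tendsto_powMeasure_empiricalMeasure_notMem ν (hU.mem_nhds hν))
  -- Under `ν^{⊗N}`, `H ≥ aN` when the empirical measure is in `U` and `H ≥ cN` otherwise. The
  -- second event has vanishing probability, so (H1) gives `E ν ≥ a` in the limit.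
  have hlim : Tendsto (fun N => a - (a - c) *
      (powMeasure N ν).real {x | empiricalMeasure N x ∉ U}) atTop (𝓝 a) := by
    simpa using (hq.const_mul (a - c)).const_sub a
  refine le_of_tendsto_of_tendsto hlim (h1.tendsto_integral hνt) ?_
  filter_upwards [hUN, hc, h1.eventually_integrable hνt, eventually_gt_atTop 0]
    with N hUN hcN hiN hN
  have hN' : (0 : ℝ) < N := by exact_mod_cast hN
  have hmeas : MeasurableSet {x : Fin N → X | empiricalMeasure N x ∉ U} :=
    measurableSet_empiricalMeasure_mem N (s := Uᶜ)
      (measurableSet_borel_of_isOpen hU).compl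
  set B := {x : Fin N → X | empiricalMeasure N x ∉ U}
  have hind : Integrable (B.indicator fun _ => (a - c) * (N : ℝ)) (powMeasure N ν) :=
    (integrable_const _).indicator hmeas
  have hle : ∫ x, (a * N - B.indicator (fun _ => (a - c) * (N : ℝ)) x) ∂(powMeasure N ν) ≤
      ∫ x, (H N x).toReal ∂(powMeasure N ν) := by
    refine integral_mono_ae ((integrable_const _).sub hind) hiN.1 ?_
    filter_upwards [hiN.2.1] with x hx
    by_cases hxB : x ∈ B
    · have := hcN x
      rw [← hx, EReal.coe_le_coe_iff] at this
      simp only [Set.indicator_of_mem hxB]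
      linarith
    · have := coe_mul_le_of_lt_div hN (hUN x (not_not.1 hxB))
      rw [← hx, EReal.coe_le_coe_iff] at this
      simpa only [Set.indicator_of_notMem hxB, sub_zero] using this
  rw [integral_sub (integrable_const _) hind, integral_indicator_const _ hmeas] at hle
  simp only [integral_const, probReal_univ, smul_eq_mul, one_mul] at hle
  rw [le_div_iff₀ hN']
  linarith

end Energy

/-! ### Logarithmic asymptotics in `EReal` -/

section Asymptotics

lemma limsup_log_div_le {Γ : ℕ → ℝ≥0∞} {r : ℕ → ℝ} (hr : Tendsto r atTop atTop) {C a : ℝ}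
    (hC : 0 < C) (h : ∀ᶠ N in atTop, Γ N ≤ ENNReal.ofReal (C * Real.exp (-(r N * a)))) :
    limsup (fun N => ENNReal.log (Γ N) / (r N : EReal)) atTop ≤ -(a : EReal) := by
  have hlim : Tendsto (fun N => ((Real.log C / r N - a : ℝ) : EReal)) atTop (𝓝 (-(a : EReal))) := by
    rw [← EReal.coe_neg, EReal.tendsto_coe]
    simpa using (hr.const_div_atTop (Real.log C)).sub_const a
  rw [← hlim.limsup_eq]
  refine limsup_le_limsup ?_
  filter_upwards [h, hr.eventually_gt_atTop 0] with N hN hr0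
  have h1 : ENNReal.log (Γ N) ≤ ((Real.log C - r N * a : ℝ) : EReal) := by
    refine (ENNReal.log_le_log hN).trans_eq ?_
    rw [ENNReal.log_ofReal_of_pos (by positivity), Real.log_mul hC.ne' (Real.exp_pos _).ne',
      Real.log_exp, sub_eq_add_neg]
  refine (EReal.div_le_div_right_of_nonneg (by exact_mod_cast hr0.le) h1).trans_eq ?_
  rw [← EReal.coe_div, sub_div, mul_div_cancel_left₀ _ hr0.ne']

lemma le_liminf_log_div {Γ : ℕ → ℝ≥0∞} {r k : ℕ → ℝ} (hr : Tendsto r atTop atTop) {L : ℝ}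
    (h : ∀ᶠ N in atTop, ENNReal.ofReal (Real.exp (k N)) ≤ Γ N)
    (hk : Tendsto (fun N => k N / r N) atTop (𝓝 L)) :
    (L : EReal) ≤ liminf (fun N => ENNReal.log (Γ N) / (r N : EReal)) atTop := by
  rw [← (EReal.tendsto_coe.2 hk).liminf_eq]
  refine liminf_le_liminf ?_
  filter_upwards [h, hr.eventually_gt_atTop 0] with N hN hr0
  rw [EReal.coe_div]
  refine EReal.div_le_div_right_of_nonneg (by exact_mod_cast hr0.le) ?_
  refine le_trans ?_ (ENNReal.log_le_log hN)
  rw [ENNReal.log_ofReal_of_pos (Real.exp_pos _), Real.log_exp]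

/-- The real number `t = 1/β` treats both cases together; `t = 0` encodes `β = ∞`. -/
lemma exists_tendsto_inv {β : ℕ → ℝ} {b : EReal} (hb : 0 < b)
    (hβ : Tendsto (fun N => (β N : EReal)) atTop (𝓝 b)) :
    ∃ t : ℝ, 0 ≤ t ∧ b⁻¹ = (t : EReal) ∧ Tendsto (fun N => (β N)⁻¹) atTop (𝓝 t) ∧
      Tendsto (fun N : ℕ => β N * N) atTop atTop ∧ (t = 0 → b = ⊤) := by
  induction b with
  | bot => exact absurd hb not_lt_bot
  | top =>
    have h := EReal.tendsto_coe_nhds_top_iff.1 hβ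
    exact ⟨0, le_rfl, EReal.inv_top, tendsto_inv_atTop_zero.comp h,
      h.atTop_mul_atTop₀ tendsto_natCast_atTop_atTop, fun _ => rfl⟩
  | coe b =>
    have h := EReal.tendsto_coe.1 hβ
    have hb' : 0 < b := by exact_mod_cast hb
    exact ⟨b⁻¹, by positivity, (EReal.coe_inv b).symm, h.inv₀ hb'.ne',
      h.pos_mul_atTop hb' tendsto_natCast_atTop_atTop, fun h0 => absurd h0 (by positivity)⟩

lemma exists_real_lt_add_mul {x D : EReal} {t a : ℝ} (ht : 0 ≤ t) (hD : 0 ≤ D)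
    (h : (a : EReal) < x + D * t) :
    ∃ a₁ a₂ : ℝ, (a₁ : EReal) < x ∧ (a₂ : EReal) < D ∧ a < a₁ + a₂ * t := by
  obtain ⟨a₁, b, ha₁, hb, hab⟩ :
      ∃ a₁ b : ℝ, (a₁ : EReal) < x ∧ (b : EReal) < D * t ∧ a < a₁ + b := by
    by_contra! hcon
    refine absurd h (not_lt.2 (EReal.add_le_of_forall_lt fun a' ha' b' hb' => ?_))
    obtain ⟨a₁, h1, h2⟩ := EReal.lt_iff_exists_real_btwn.1 ha'
    obtain ⟨b, h3, h4⟩ := EReal.lt_iff_exists_real_btwn.1 hb'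
    exact (add_le_add h1.le h3.le).trans (by exact_mod_cast hcon a₁ b h2 h4)
  rcases ht.eq_or_lt with rfl | ht
  -- For `t = 0` the entropy plays no role, and any real number below `D ≥ 0` serves.
  · refine ⟨a₁, -1, ha₁, lt_of_lt_of_le (by norm_cast) hD, ?_⟩
    simp only [EReal.coe_zero, mul_zero] at hb
    have : b < 0 := by exact_mod_cast hb
    linarith
  · refine ⟨a₁, b / t, ha₁, ?_, by rwa [div_mul_cancel₀ _ ht.ne']⟩
    rw [EReal.coe_div]
    exact (EReal.div_lt_iff (by exact_mod_cast ht) (EReal.coe_ne_top t)).2 hb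

end Asymptotics

/-! ### Large deviation upper bound -/

section UpperBound

variable {X : Type*} [MeasurableSpace X] {μ₀ : ProbabilityMeasure X}
  {H : (N : ℕ) → (Fin N → X) → EReal} {E : ProbabilityMeasure X → EReal} {b : EReal} {t : ℝ}

lemma freeEnergy_eq (hb : b⁻¹ = (t : EReal)) (μ : ProbabilityMeasure X) :
    freeEnergy μ₀ E b μ = E μ + (klDiv (μ : Measure X) (μ₀ : Measure X) : EReal) * t := by
  rw [freeEnergy, EReal.div_eq_inv_mul, hb, mul_comm]

lemma freeEnergy_ne_bot (hE : ∀ μ, E μ ≠ ⊥) (hb : 0 ≤ b) (μ : ProbabilityMeasure X) :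
    freeEnergy μ₀ E b μ ≠ ⊥ := by
  rw [freeEnergy, ← bot_lt_iff_ne_bot, EReal.bot_lt_add_iff]
  exact ⟨bot_lt_iff_ne_bot.2 (hE μ),
    (EReal.bot_lt_zero).trans_le (EReal.div_nonneg (EReal.coe_ennreal_nonneg _) hb)⟩

lemma boltzmannMeasure_le {β c : ℝ} (hβ : 0 ≤ β) {N : ℕ} {s : Set (Fin N → X)}
    (hs : MeasurableSet s) (h : ∀ x ∈ s, (c : EReal) ≤ H N x) :
    boltzmannMeasure μ₀ H β N s ≤ ENNReal.ofReal (Real.exp (-(β * c))) * powMeasure N μ₀ s := by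
  rw [boltzmannMeasure, withDensity_apply _ hs, ← setLIntegral_const]
  refine setLIntegral_mono' hs fun x hx => ?_
  rw [← EReal.exp_coe, EReal.exp_le_exp_iff, EReal.coe_neg, EReal.coe_mul, EReal.neg_le_neg_iff]
  exact mul_le_mul_of_nonneg_left (h x hx) (by exact_mod_cast hβ)

variable [TopologicalSpace X] [CompactSpace X] [TopologicalSpace.MetrizableSpace X] [BorelSpace X]

lemma lowerSemicontinuous_freeEnergy (hE : LowerSemicontinuous E) (hE' : ∀ μ, E μ ≠ ⊥)
    (ht : 0 ≤ t) (hb : b⁻¹ = (t : EReal)) : LowerSemicontinuous (freeEnergy μ₀ E b) := by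
  have hD : LowerSemicontinuous fun μ : ProbabilityMeasure X =>
      (klDiv (μ : Measure X) (μ₀ : Measure X) : EReal) * t := by
    rcases ht.eq_or_lt with rfl | ht
    · simpa using lowerSemicontinuous_const
    · refine Continuous.comp_lowerSemicontinuous (g := fun x : EReal => x * t) ?_
        (lowerSemicontinuous_klDiv μ₀) fun x y hxy => ?_
      · refine continuous_iff_continuousAt.2 fun x => ?_
        exact EReal.Tendsto.mul_const tendsto_id (Or.inr (EReal.coe_ne_bot t))
          (Or.inr (EReal.coe_ne_top t)) 
      · exact mul_le_mul_of_nonneg_right hxy (by exact_mod_cast ht.le)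
  have hsum : freeEnergy μ₀ E b = fun μ => E μ +
      (klDiv (μ : Measure X) (μ₀ : Measure X) : EReal) * t := funext (freeEnergy_eq hb)
  rw [hsum]
  refine hE.add' hD fun μ => EReal.continuousAt_add (Or.inr ?_) (Or.inl (hE' μ))
  exact (EReal.bot_lt_zero.trans_le (mul_nonneg (EReal.coe_ennreal_nonneg _)
    (by exact_mod_cast ht))).ne'

variable [Nonempty X]

/-- On `U` the Boltzmann weight is at most `exp (-β_N N a₁)`, and `V` has probability at most `exp
(-N a₂)`. The total rate at speed `β_N N` is `a₁ + a₂ / β_N`, eventually above `a`. -/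
lemma exists_open_boltzmannMeasure_le (h2 : HypH2' H E) {β : ℕ → ℝ} (hβ : ∀ N, 0 < β N)
    (ht : 0 ≤ t) (hb : b⁻¹ = (t : EReal)) (hβt : Tendsto (fun N => (β N)⁻¹) atTop (𝓝 t))
    {μ : ProbabilityMeasure X} {a : ℝ} (ha : (a : EReal) < freeEnergy μ₀ E b μ) :
    ∃ U, IsOpen U ∧ μ ∈ U ∧ ∀ᶠ N : ℕ in atTop,
      boltzmannMeasure μ₀ H (β N) N {x | empiricalMeasure N x ∈ U} ≤
        ENNReal.ofReal (Real.exp (-(β N * N * a))) := by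
  rw [freeEnergy_eq hb] at ha
  obtain ⟨a₁, a₂, h₁, h₂, h₁₂⟩ := exists_real_lt_add_mul ht (EReal.coe_ennreal_nonneg _) ha
  obtain ⟨U, hU, hμU, hUN⟩ := h2.exists_open h₁
  obtain ⟨V, hV, hμV, hVN⟩ := exists_open_powMeasure_le h₂
  refine ⟨U ∩ V, hU.inter hV, ⟨hμU, hμV⟩, ?_⟩
  have hlim : Tendsto (fun N => a₁ + a₂ * (β N)⁻¹) atTop (𝓝 (a₁ + a₂ * t)) :=
    (hβt.const_mul a₂).const_add a₁
  filter_upwards [hUN, hlim.eventually (lt_mem_nhds h₁₂), eventually_gt_atTop 0] with N hN haN hN0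
  have hβN := hβ N
  have hm := measurableSet_empiricalMeasure_mem N (measurableSet_borel_of_isOpen (hU.inter hV))
  refine (boltzmannMeasure_le hβN.le hm
    fun x hx => coe_mul_le_of_lt_div hN0 (hN x hx.1)).trans ?_
  have h3 : powMeasure N μ₀ {x | empiricalMeasure N x ∈ U ∩ V} ≤
      ENNReal.ofReal (Real.exp (-(N * a₂))) :=
    (measure_mono fun x hx => hx.2).trans (hVN N hN0.ne')
  refine (mul_le_mul_right h3 _).trans ?_
  rw [← ENNReal.ofReal_mul (Real.exp_pos _).le, ← Real.exp_add]
  refine ENNReal.ofReal_le_ofReal (Real.exp_le_exp.2 ?_)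
  have h4 : β N * N * a ≤ β N * N * (a₁ + a₂ * (β N)⁻¹) :=
    mul_le_mul_of_nonneg_left haN.le (by positivity)
  have h5 : β N * N * (a₁ + a₂ * (β N)⁻¹) = β N * (a₁ * N) + N * a₂ := by
    field_simp
  linarith

lemma limsup_log_boltzmannMeasure_le (h2 : HypH2' H E) {β : ℕ → ℝ} (hβ : ∀ N, 0 < β N)
    (ht : 0 ≤ t) (hb : b⁻¹ = (t : EReal)) (hβt : Tendsto (fun N => (β N)⁻¹) atTop (𝓝 t))
    (hr : Tendsto (fun N : ℕ => β N * N) atTop atTop) {F : Set (ProbabilityMeasure X)}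
    (hF : IsClosed F) :
    limsup (fun N : ℕ => ENNReal.log (empiricalLaw N (boltzmannMeasure μ₀ H (β N) N) F) /
      ((β N * N : ℝ) : EReal)) atTop ≤ -⨅ μ ∈ F, freeEnergy μ₀ E b μ := by
  rw [EReal.le_neg]
  refine EReal.ge_of_forall_gt_iff_ge.1 fun a ha => ?_
  rw [EReal.le_neg]
  -- A finite cover adds up the local bounds; the constant `C` disappears at speed `β_N N`.
  obtain ⟨C, hC, hCN⟩ : ∃ C : ℝ, 0 < C ∧ ∀ᶠ N : ℕ in atTop,
      boltzmannMeasure μ₀ H (β N) N {x | empiricalMeasure N x ∈ F} ≤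
        ENNReal.ofReal (C * Real.exp (-(β N * N * a))) := by
    refine hF.isCompact.induction_on (p := fun s => ∃ C : ℝ, 0 < C ∧ ∀ᶠ N : ℕ in atTop,
      boltzmannMeasure μ₀ H (β N) N {x | empiricalMeasure N x ∈ s} ≤
        ENNReal.ofReal (C * Real.exp (-(β N * N * a)))) ⟨1, one_pos, by simp⟩ ?_ ?_ ?_
    · rintro s s' hss ⟨C, hC, h⟩
      exact ⟨C, hC, h.mono fun N hN => le_trans (measure_mono fun x hx => hss hx) hN⟩
    · rintro s s' ⟨C, hC, h⟩ ⟨C', hC', h'⟩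
      refine ⟨C + C', add_pos hC hC', ?_⟩
      filter_upwards [h, h'] with N hN hN'
      rw [add_mul, ENNReal.ofReal_add (by positivity) (by positivity)]
      exact (measure_union_le {x | empiricalMeasure N x ∈ s}
        {x | empiricalMeasure N x ∈ s'}).trans (add_le_add hN hN')
    · intro μ hμ
      have haμ : (a : EReal) < freeEnergy μ₀ E b μ := ha.trans_le (biInf_le _ hμ)
      obtain ⟨U, hU, hμU, h⟩ := exists_open_boltzmannMeasure_le h2 hβ ht hb hβt haμ
      exact ⟨U, mem_nhdsWithin_of_mem_nhds (hU.mem_nhds hμU), 1, one_pos, by simpa using h⟩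
  refine limsup_log_div_le hr hC ?_
  filter_upwards [hCN] with N hN
  rwa [empiricalLaw_apply]
  rw [← compl_compl F]
  exact (measurableSet_borel_of_isOpen hF.isOpen_compl).compl

end UpperBound

/-! ### Change of measure -/

section Tilting

lemma ofReal_integral_le_lintegral_ofReal {Ω : Type*} [MeasurableSpace Ω] {ρ : Measure Ω}
    {f : Ω → ℝ} (hf : Integrable f ρ) :
    ENNReal.ofReal (∫ x, f x ∂ρ) ≤ ∫⁻ x, ENNReal.ofReal (f x) ∂ρ := by
  rw [integral_eq_lintegral_pos_part_sub_lintegral_neg_part hf]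
  exact (ENNReal.ofReal_le_ofReal (sub_le_self _ ENNReal.toReal_nonneg)).trans
    ENNReal.ofReal_toReal_le

/-- A lower bound for an exponential integral after a change of measure, obtained from Jensen's
inequality on the set `A`. -/
lemma ofReal_exp_le_setLIntegral {Ω : Type*} [MeasurableSpace Ω] {ρ₀ ρ : Measure Ω}
    [IsProbabilityMeasure ρ₀] [IsProbabilityMeasure ρ] {L : Ω → ℝ≥0∞} (hL : Measurable L)
    (hρ : ρ = ρ₀.withDensity L) {ℓ : Ω → ℝ} (hℓ : Integrable ℓ ρ)
    (hLℓ : ∀ᵐ x ∂ρ, L x = ENNReal.ofReal (Real.exp (ℓ x))) {φ : Ω → ℝ} (hφ : Integrable φ ρ)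
    {F : Ω → ℝ≥0∞} (hF : ∀ᵐ x ∂ρ, F x = ENNReal.ofReal (Real.exp (-φ x))) {A : Set Ω}
    (hA : MeasurableSet A) (hp : 0 < ρ.real A) :
    ENNReal.ofReal (Real.exp (Real.log (ρ.real A) -
      (∫ x in A, φ x ∂ρ + ∫ x, ℓ x ∂ρ + 1) / ρ.real A)) ≤ ∫⁻ x in A, F x ∂ρ₀ := by
  -- Only an inequality, since `L` may take the values `0` and `∞`, where `L * L⁻¹ = 0`.
  have hLinv : ∀ (G : Ω → ℝ≥0∞) {B : Set Ω}, MeasurableSet B →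
      ∫⁻ x in B, G x * (L x)⁻¹ ∂ρ ≤ ∫⁻ x in B, G x ∂ρ₀ := fun G B hB => by
    rw [hρ, restrict_withDensity hB]
    refine (lintegral_withDensity_le_lintegral_mul _ hL _).trans (lintegral_mono fun x => ?_)
    calc L x * (G x * (L x)⁻¹) = G x * (L x * (L x)⁻¹) := by ring
      _ ≤ G x * 1 := mul_le_mul_right (ENNReal.mul_inv_le_one _) _
      _ = G x := mul_one _
  have hexp : ∫⁻ x, ENNReal.ofReal (Real.exp (-ℓ x)) ∂ρ ≤ 1 := by
    calc ∫⁻ x, ENNReal.ofReal (Real.exp (-ℓ x)) ∂ρ = ∫⁻ x, 1 * (L x)⁻¹ ∂ρ := by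
          refine lintegral_congr_ae ?_
          filter_upwards [hLℓ] with x hx
          rw [hx, one_mul, Real.exp_neg, ENNReal.ofReal_inv_of_pos (Real.exp_pos _)]
      _ ≤ ∫⁻ _, 1 ∂ρ₀ := by simpa using hLinv (fun _ => 1) MeasurableSet.univ
      _ = 1 := by simp
  have hexpi : Integrable (fun x => Real.exp (-ℓ x)) ρ := by
    refine ⟨(Real.measurable_exp.comp_aemeasurable
      hℓ.aestronglyMeasurable.aemeasurable.neg).aestronglyMeasurable, ?_⟩
    rw [hasFiniteIntegral_iff_ofReal (ae_of_all _ fun x => (Real.exp_pos _).le)]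
    exact hexp.trans_lt ENNReal.one_lt_top
  -- Source of the `+ 1` in the bound: it allows `∫ ℓ` over `A` to be replaced by the full integral,
  -- which is the entropy in the application.
  have hcompl : -∫ x in Aᶜ, ℓ x ∂ρ ≤ 1 := by
    rw [← integral_neg]
    calc ∫ x in Aᶜ, -ℓ x ∂ρ ≤ ∫ x in Aᶜ, Real.exp (-ℓ x) ∂ρ :=
          integral_mono hℓ.neg.integrableOn hexpi.integrableOn fun x => by
            have := Real.add_one_le_exp (-ℓ x)
            simp only
            linarith
      _ ≤ ∫ x, Real.exp (-ℓ x) ∂ρ :=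
          setIntegral_le_integral hexpi (ae_of_all _ fun x => (Real.exp_pos _).le)
      _ ≤ 1 := by
          rw [integral_eq_lintegral_of_nonneg_ae (ae_of_all _ fun x => (Real.exp_pos _).le)
            hexpi.aestronglyMeasurable]
          exact ENNReal.toReal_le_of_le_ofReal zero_le_one (by simpa using hexp)
  have hsplit := integral_add_compl hA hℓ
  set p := ρ.real A with hpdef
  set K := ∫ x in A, φ x ∂ρ + ∫ x, ℓ x ∂ρ + 1 with hK
  -- Jensen's inequality in tangent form: `exp (-s) ≥ exp (-c) (1 + c - s)` with `s = φ + ℓ`. As `∫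
  -- s` over `A` is at most `K = p c`, integrating leaves at least `p exp (-c)`.
  set c := K / p with hc
  have hint : Integrable (fun x => Real.exp (-c) * (1 + c - (φ x + ℓ x))) (ρ.restrict A) :=
    (((integrable_const _).sub (hφ.add hℓ)).const_mul _).integrableOn
  calc ENNReal.ofReal (Real.exp (Real.log p - c))
      ≤ ENNReal.ofReal (∫ x in A, Real.exp (-c) * (1 + c - (φ x + ℓ x)) ∂ρ) := by
        refine ENNReal.ofReal_le_ofReal ?_
        have hi : Integrable (fun x => φ x + ℓ x) (ρ.restrict A) := (hφ.add hℓ).integrableOn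
        rw [integral_const_mul, integral_sub (integrable_const _) hi,
          integral_add hφ.integrableOn hℓ.integrableOn, integral_const, sub_eq_add_neg,
          Real.exp_add, Real.exp_log hp, mul_comm]
        refine mul_le_mul_of_nonneg_left ?_ (Real.exp_pos _).le
        have h1 : p * c = K := by rw [hc, mul_div_cancel₀ _ hp.ne']
        rw [measureReal_restrict_apply_univ, smul_eq_mul, ← hpdef]
        linarith
    _ ≤ ∫⁻ x in A, ENNReal.ofReal (Real.exp (-c) * (1 + c - (φ x + ℓ x))) ∂ρ :=
        ofReal_integral_le_lintegral_ofReal hint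
    _ ≤ ∫⁻ x in A, F x * (L x)⁻¹ ∂ρ := by
        refine lintegral_mono_ae (ae_restrict_of_ae ?_)
        filter_upwards [hLℓ, hF] with x h1 h2
        rw [h1, h2, ← ENNReal.ofReal_inv_of_pos (Real.exp_pos _), ← Real.exp_neg,
          ← ENNReal.ofReal_mul (Real.exp_pos _).le, ← Real.exp_add]
        refine ENNReal.ofReal_le_ofReal ?_
        have h3 : Real.exp (-φ x + -ℓ x) = Real.exp (-c) * Real.exp (c - (φ x + ℓ x)) := by
          rw [← Real.exp_add]; congr 1; ring
        rw [h3]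
        have := Real.add_one_le_exp (c - (φ x + ℓ x))
        exact mul_le_mul_of_nonneg_left (by linarith) (Real.exp_pos _).le
    _ ≤ ∫⁻ x in A, F x ∂ρ₀ := hLinv F hA

variable {X : Type*} [MeasurableSpace X]

/-- It suffices to test boxes, where the integrand factors into functions of independent
coordinates. -/
lemma powMeasure_eq_withDensity {μ μ₀ : ProbabilityMeasure X}
    (hac : (μ : Measure X) ≪ (μ₀ : Measure X)) (N : ℕ) :
    powMeasure N μ = (powMeasure N μ₀).withDensity
      fun x => ∏ i, (μ : Measure X).rnDeriv (μ₀ : Measure X) (x i) := by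
  set g := (μ : Measure X).rnDeriv (μ₀ : Measure X) with hg
  have hgm : Measurable g := Measure.measurable_rnDeriv _ _
  refine Measure.pi_eq fun s hs => ?_
  have hind : ∀ i, Measurable fun y => (s i).indicator g y := fun i => hgm.indicator (hs i)
  rw [withDensity_apply _ (MeasurableSet.univ_pi hs),
    ← lintegral_indicator (MeasurableSet.univ_pi hs)]
  have h1 : ∀ x : Fin N → X, (Set.univ.pi s).indicator (fun x => ∏ i, g (x i)) x =
      ∏ i, (s i).indicator g (x i) := fun x => by
    by_cases hx : x ∈ Set.univ.pi s
    · rw [Set.indicator_of_mem hx]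
      exact Finset.prod_congr rfl fun i _ => (Set.indicator_of_mem (hx i trivial) g).symm
    · rw [Set.indicator_of_notMem hx]
      obtain ⟨i, hi⟩ : ∃ i, x i ∉ s i := by simpa [Set.mem_univ_pi] using hx
      exact (Finset.prod_eq_zero (Finset.mem_univ i) (Set.indicator_of_notMem hi g)).symm
  simp_rw [h1]
  rw [powMeasure, ProbabilityTheory.lintegral_prod_eq_prod_lintegral_of_indepFun Finset.univ
    (fun i (x : Fin N → X) => (s i).indicator g (x i))
    (ProbabilityTheory.iIndepFun_pi fun i => (hind i).aemeasurable)
    fun i => (hind i).comp (measurable_pi_apply i)]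
  refine Finset.prod_congr rfl fun i _ => ?_
  have h2 := (measurePreserving_eval (fun _ : Fin N => (μ₀ : Measure X)) i).lintegral_comp (hind i)
  refine h2.trans ?_
  rw [lintegral_indicator (hs i), hg, Measure.setLIntegral_rnDeriv hac]

lemma prod_rnDeriv_ae_eq {μ μ₀ : ProbabilityMeasure X}
    (hac : (μ : Measure X) ≪ (μ₀ : Measure X)) (N : ℕ) :
    ∀ᵐ x ∂(powMeasure N μ), ∏ i, (μ : Measure X).rnDeriv (μ₀ : Measure X) (x i) =
      ENNReal.ofReal (Real.exp (∑ i, llr (μ : Measure X) (μ₀ : Measure X) (x i))) := by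
  have h1 : ∀ᵐ y ∂(μ : Measure X), (μ : Measure X).rnDeriv (μ₀ : Measure X) y =
      ENNReal.ofReal (Real.exp (llr (μ : Measure X) (μ₀ : Measure X) y)) := by
    filter_upwards [exp_llr_of_ac (μ : Measure X) (μ₀ : Measure X) hac,
      hac.ae_le (Measure.rnDeriv_lt_top (μ : Measure X) (μ₀ : Measure X))] with y h2 h3
    rw [h2, ENNReal.ofReal_toReal h3.ne]
  have h2 : ∀ᵐ x ∂(powMeasure N μ), ∀ i, (μ : Measure X).rnDeriv (μ₀ : Measure X) (x i) =
      ENNReal.ofReal (Real.exp (llr (μ : Measure X) (μ₀ : Measure X) (x i))) :=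
    ae_all_iff.2 fun i => (Measure.quasiMeasurePreserving_eval
      (μ := fun _ : Fin N => (μ : Measure X)) i).ae h1
  filter_upwards [h2] with x hx
  rw [Real.exp_sum, ENNReal.ofReal_prod_of_nonneg fun i _ => (Real.exp_pos _).le]
  exact Finset.prod_congr rfl fun i _ => hx i

lemma integrable_llr_eval {μ μ₀ : ProbabilityMeasure X}
    (hint : Integrable (llr (μ : Measure X) (μ₀ : Measure X)) (μ : Measure X)) {N : ℕ}
    (i : Fin N) :
    Integrable (fun x : Fin N → X => llr (μ : Measure X) (μ₀ : Measure X) (x i))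
      (powMeasure N μ) :=
  (measurePreserving_eval (fun _ : Fin N => (μ : Measure X)) i).integrable_comp_of_integrable hint

lemma integrable_sum_llr {μ μ₀ : ProbabilityMeasure X}
    (hint : Integrable (llr (μ : Measure X) (μ₀ : Measure X)) (μ : Measure X)) (N : ℕ) :
    Integrable (fun x : Fin N → X => ∑ i, llr (μ : Measure X) (μ₀ : Measure X) (x i))
      (powMeasure N μ) :=
  integrable_finsetSum _ fun i _ => integrable_llr_eval hint i

lemma integral_sum_llr {μ μ₀ : ProbabilityMeasure X}
    (hac : (μ : Measure X) ≪ (μ₀ : Measure X))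
    (hint : Integrable (llr (μ : Measure X) (μ₀ : Measure X)) (μ : Measure X)) (N : ℕ) :
    ∫ x : Fin N → X, ∑ i, llr (μ : Measure X) (μ₀ : Measure X) (x i) ∂(powMeasure N μ) =
      N * (klDiv (μ : Measure X) (μ₀ : Measure X)).toReal := by
  rw [integral_finsetSum _ fun i _ => integrable_llr_eval hint i]
  have h : ∀ i : Fin N, ∫ x : Fin N → X, llr (μ : Measure X) (μ₀ : Measure X) (x i)
      ∂(powMeasure N μ) = (klDiv (μ : Measure X) (μ₀ : Measure X)).toReal := fun i => by
    rw [toReal_klDiv_of_measure_eq hac (by simp)]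
    exact integral_comp_eval (μ := fun _ : Fin N => (μ : Measure X)) hint.aestronglyMeasurable
  simp [h]

end Tilting

/-! ### Large deviation lower bound -/

section LowerBound

variable {X : Type*} [MeasurableSpace X] {μ₀ : ProbabilityMeasure X}
  {H : (N : ℕ) → (Fin N → X) → EReal} {E : ProbabilityMeasure X → EReal} {b : EReal} {t : ℝ}
  [TopologicalSpace X] [CompactSpace X] [TopologicalSpace.MetrizableSpace X] [BorelSpace X]
  [Nonempty X]

/-- Tilting to `μ^{⊗N}` has entropy cost `N D`, which is `D / β_N` at speed `β_N N`. The probability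
of `G` tends to `1`, so restricting to it costs nothing in the limit. -/
lemma le_liminf_log_boltzmannMeasure_of_klDiv_ne_top (h1 : HypH1 μ₀ H E) (h2 : HypH2' H E)
    {β : ℕ → ℝ} (hβ : ∀ N, 0 < β N) (hβt : Tendsto (fun N => (β N)⁻¹) atTop (𝓝 t))
    (hr : Tendsto (fun N : ℕ => β N * N) atTop atTop) {G : Set (ProbabilityMeasure X)}
    (hG : IsOpen G) {μ : ProbabilityMeasure X} (hμG : μ ∈ G) (hμ : E μ < ⊤)
    (hkl : klDiv (μ : Measure X) (μ₀ : Measure X) ≠ ∞) :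
    ((-((E μ).toReal + (klDiv (μ : Measure X) (μ₀ : Measure X)).toReal * t) : ℝ) : EReal) ≤
      liminf (fun N : ℕ => ENNReal.log (empiricalLaw N (boltzmannMeasure μ₀ H (β N) N) G) /
        ((β N * N : ℝ) : EReal)) atTop := by
  obtain ⟨hac, hllr⟩ := klDiv_ne_top_iff.1 hkl
  obtain ⟨c, hc⟩ := h2.exists_le h1.ne_bot
  set D := (klDiv (μ : Measure X) (μ₀ : Measure X)).toReal with hD
  let A : (N : ℕ) → Set (Fin N → X) := fun N => {x | empiricalMeasure N x ∈ G}
  have hA : ∀ N, MeasurableSet (A N) := fun N =>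
    measurableSet_empiricalMeasure_mem N (measurableSet_borel_of_isOpen hG)
  have hq : Tendsto (fun N => (powMeasure N μ).real (A N)ᶜ) atTop (𝓝 0) :=
    (ENNReal.tendsto_toReal ENNReal.zero_ne_top).comp
      (tendsto_powMeasure_empiricalMeasure_notMem μ (hG.mem_nhds hμG))
  have hp : Tendsto (fun N => (powMeasure N μ).real (A N)) atTop (𝓝 1) := by
    have h : (fun N => (powMeasure N μ).real (A N)) =
        fun N => 1 - (powMeasure N μ).real (A N)ᶜ := funext fun N => by
      rw [probReal_compl_eq_one_sub (hA N)]; ring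
    rw [h]
    simpa using hq.const_sub 1
  -- The energy over `A N` is bounded above by the full energy minus the lower bound `c N` times the
  -- probability of the complement.
  let k : ℕ → ℝ := fun N => Real.log ((powMeasure N μ).real (A N)) -
    (β N * (∫ x, (H N x).toReal ∂(powMeasure N μ) - c * N * (powMeasure N μ).real (A N)ᶜ) +
      N * D + 1) / (powMeasure N μ).real (A N)
  refine le_liminf_log_div (k := k) hr ?_ ?_
  · filter_upwards [hc, h1.eventually_integrable hμ, hp.eventually (lt_mem_nhds one_pos)]
      with N hcN ⟨hiN, haeN, _⟩ hpN
    have key := ofReal_exp_le_setLIntegral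
      (L := fun x : Fin N → X => ∏ i, (μ : Measure X).rnDeriv (μ₀ : Measure X) (x i)) (by fun_prop)
      (powMeasure_eq_withDensity hac N) (integrable_sum_llr hllr N) (prod_rnDeriv_ae_eq hac N)
      (hiN.const_mul (β N)) (F := fun x => EReal.exp (-((β N : EReal) * H N x)))
      (by
        filter_upwards [haeN] with x hx
        rw [← hx, ← EReal.coe_mul, ← EReal.coe_neg, EReal.exp_coe, EReal.toReal_coe])
      (hA N) hpN
    rw [empiricalLaw_apply _ _ (measurableSet_borel_of_isOpen hG), boltzmannMeasure,
      withDensity_apply _ (hA N)]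
    refine le_trans (ENNReal.ofReal_le_ofReal (Real.exp_le_exp.2 ?_)) key
    rw [integral_sum_llr hac hllr, ← hD, integral_const_mul]
    refine sub_le_sub_left (div_le_div_of_nonneg_right ?_ hpN.le) _
    have hsplit := integral_add_compl (hA N) hiN
    have hge : c * N * (powMeasure N μ).real (A N)ᶜ ≤
        ∫ x in (A N)ᶜ, (H N x).toReal ∂(powMeasure N μ) := by
      have : ∫ x in (A N)ᶜ, c * (N : ℝ) ∂(powMeasure N μ) ≤
          ∫ x in (A N)ᶜ, (H N x).toReal ∂(powMeasure N μ) := by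
        refine integral_mono_ae (integrable_const _) hiN.integrableOn (ae_restrict_of_ae ?_)
        filter_upwards [haeN] with x hx
        have := hcN x
        rwa [← hx, EReal.coe_le_coe_iff] at this
      rwa [setIntegral_const, smul_eq_mul, mul_comm] at this
    have := mul_le_mul_of_nonneg_left (a := β N) (show
      ∫ x in A N, (H N x).toReal ∂(powMeasure N μ) ≤ ∫ x, (H N x).toReal ∂(powMeasure N μ) -
        c * N * (powMeasure N μ).real (A N)ᶜ by linarith) (hβ N).le
    linarith
  · have hlim : Tendsto (fun N : ℕ => Real.log ((powMeasure N μ).real (A N)) / (β N * N) -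
        ((∫ x, (H N x).toReal ∂(powMeasure N μ)) / N - c * (powMeasure N μ).real (A N)ᶜ +
          D * (β N)⁻¹ + 1 / (β N * N)) / (powMeasure N μ).real (A N)) atTop
        (𝓝 (0 - ((E μ).toReal - c * 0 + D * t + 0) / 1)) := by
      have hlog := (Real.continuousAt_log one_ne_zero).tendsto.comp hp
      rw [Real.log_one] at hlog
      exact (hlog.div_atTop hr).sub (((((h1.tendsto_integral hμ).sub (hq.const_mul c)).add
        (hβt.const_mul D)).add (hr.const_div_atTop 1)).div hp one_ne_zero)
    have hval : (0 - ((E μ).toReal - c * 0 + D * t + 0) / 1) = -((E μ).toReal + D * t) := by ring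
    rw [hval] at hlim
    refine hlim.congr' ?_
    filter_upwards [hp.eventually (lt_mem_nhds one_pos), eventually_gt_atTop 0] with N hpN hN
    have hN' : (0 : ℝ) < N := by exact_mod_cast hN
    have := hβ N
    simp only [k]
    field_simp

lemma le_liminf_log_boltzmannMeasure (h1 : HypH1 μ₀ H E) (h2 : HypH2' H E)
    {β : ℕ → ℝ} (hβ : ∀ N, 0 < β N) (ht : 0 ≤ t) (hb : b⁻¹ = (t : EReal))
    (hβt : Tendsto (fun N => (β N)⁻¹) atTop (𝓝 t))
    (hr : Tendsto (fun N : ℕ => β N * N) atTop atTop) (h3 : t = 0 → HypH3 μ₀ E)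
    {G : Set (ProbabilityMeasure X)} (hG : IsOpen G) :
    -⨅ μ ∈ G, freeEnergy μ₀ E b μ ≤
      liminf (fun N : ℕ => ENNReal.log (empiricalLaw N (boltzmannMeasure μ₀ H (β N) N) G) /
        ((β N * N : ℝ) : EReal)) atTop := by
  rw [EReal.neg_le]
  refine le_iInf₂ fun μ hμG => ?_
  rw [EReal.neg_le, freeEnergy_eq hb]
  set D := klDiv (μ : Measure X) (μ₀ : Measure X) with hD
  have hDt : (0 : EReal) ≤ (D : EReal) * t :=
    mul_nonneg (EReal.coe_ennreal_nonneg _) (by exact_mod_cast ht)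
  rcases eq_or_ne (E μ) ⊤ with hE | hE
  · rw [hE, EReal.top_add_of_ne_bot (EReal.bot_lt_zero.trans_le hDt).ne', EReal.neg_top]
    exact bot_le
  have hE' : E μ < ⊤ := lt_top_iff_ne_top.2 hE
  -- At `t = 0` a `μ` of infinite entropy still has a finite rate, so (H3) is needed. For `t > 0`
  -- its rate is `∞` and there is nothing to prove.
  rcases ht.eq_or_lt with rfl | htpos
  · rw [EReal.coe_zero, mul_zero, add_zero]
    obtain ⟨ν, hν, hνD, hνE⟩ := h3 rfl μ hE'
    have hneg : Tendsto (fun j => -E (ν j)) atTop (𝓝 (-E μ)) :=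
      (continuous_neg (G := EReal)).continuousAt.tendsto.comp hνE
    refine le_of_tendsto hneg ?_
    filter_upwards [hν.eventually (hG.mem_nhds hμG), hνE.eventually (gt_mem_nhds hE')]
      with j hjG hjE
    have := le_liminf_log_boltzmannMeasure_of_klDiv_ne_top h1 h2 hβ hβt hr hG hjG hjE
      (hνD j).2.ne
    rwa [mul_zero, add_zero, EReal.coe_neg, EReal.coe_toReal hjE.ne (h1.ne_bot _)] at this
  · rcases eq_or_ne D ∞ with hDtop | hDtop
    · rw [hDtop, EReal.coe_ennreal_top, EReal.top_mul_coe_of_pos htpos,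
        EReal.add_top_of_ne_bot (h1.ne_bot μ), EReal.neg_top]
      exact bot_le
    · have := le_liminf_log_boltzmannMeasure_of_klDiv_ne_top h1 h2 hβ hβt hr hG hμG hE' hDtop
      rwa [EReal.coe_neg, EReal.coe_add, EReal.coe_mul, EReal.coe_toReal hE (h1.ne_bot μ),
        EReal.coe_ennreal_toReal hDtop] at this

end LowerBound

/-! ### Normalizing a large deviation principle -/

section Normalization

lemma biInf_sub_coe {Y : Type*} (I : Y → EReal) (S : Set Y) (m : ℝ) :
    ⨅ y ∈ S, (I y - (m : EReal)) = (⨅ y ∈ S, I y) - (m : EReal) := by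
  refine le_antisymm ?_ (le_iInf₂ fun y hy => EReal.sub_le_sub (biInf_le _ hy) le_rfl)
  rw [EReal.le_sub_iff_add_le (Or.inl (EReal.coe_ne_bot m)) (Or.inl (EReal.coe_ne_top m))]
  refine le_iInf₂ fun y hy => ?_
  exact (add_le_add_left (biInf_le _ hy) _).trans_eq (EReal.sub_add_cancel)

variable {Y : Type*} [TopologicalSpace Y] {Γ : ℕ → @Measure Y (borel Y)} {r : ℕ → ℝ} {I : Y → EReal}

lemma SatisfiesLDP.tendsto_log_univ (h : SatisfiesLDP Γ r I) :
    Tendsto (fun N => ENNReal.log (Γ N Set.univ) / (r N : EReal)) atTop (𝓝 (-⨅ y, I y)) := by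
  have h1 := h.lower Set.univ isOpen_univ
  have h2 := h.upper Set.univ isClosed_univ
  simp only [Set.mem_univ, iInf_pos] at h1 h2
  exact tendsto_of_le_liminf_of_limsup_le h1 h2

/-- Normalizing a sequence of measures that satisfies a large deviation principle. -/
lemma SatisfiesLDP.normalize (h : SatisfiesLDP Γ r I) (hr : ∀ᶠ N in atTop, 0 < r N) {m : ℝ}
    (hm : ⨅ y, I y = m) {Γ' : ℕ → @Measure Y (borel Y)}
    (hΓ' : ∀ N, ∀ s, @MeasurableSet Y (borel Y) s → Γ' N s = (Γ N Set.univ)⁻¹ * Γ N s) :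
    SatisfiesLDP Γ' r fun y => I y - ⨅ z, I z := by
  have hlim : Tendsto (fun N => -(ENNReal.log (Γ N Set.univ) / (r N : EReal))) atTop
      (𝓝 (m : EReal)) := by
    have := (continuous_neg (G := EReal)).continuousAt.tendsto.comp h.tendsto_log_univ
    rwa [neg_neg, hm] at this
  -- Normalization subtracts `log Γ_N(Y) / r_N`, which converges to the real number `-m`. Finiteness
  -- of the limit keeps the sums in `EReal` well behaved.
  have heq : ∀ s, @MeasurableSet Y (borel Y) s →
      (fun N => ENNReal.log (Γ' N s) / (r N : EReal)) =ᶠ[atTop]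
        (fun N => ENNReal.log (Γ N s) / (r N : EReal)) +
          fun N => -(ENNReal.log (Γ N Set.univ) / (r N : EReal)) := fun s hs => by
    filter_upwards [hr] with N hN
    have hinv : (0 : EReal) ≤ (r N : EReal)⁻¹ := EReal.inv_nonneg_of_nonneg (by exact_mod_cast hN.le)
    have hinv' : (r N : EReal)⁻¹ ≠ ⊤ := by rw [← EReal.coe_inv]; exact EReal.coe_ne_top _
    rw [Pi.add_apply, hΓ' N s hs, ENNReal.log_mul_add, ENNReal.log_inv, add_comm]
    simp only [EReal.div_eq_inv_mul]
    rw [EReal.left_distrib_of_nonneg_of_ne_top hinv hinv', mul_neg]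
  have hneg : ∀ S : Set Y, -⨅ y ∈ S, (I y - ⨅ z, I z) = (-⨅ y ∈ S, I y) + (m : EReal) := fun S => by
    rw [hm, biInf_sub_coe, EReal.neg_sub (Or.inr (EReal.coe_ne_bot m)) (Or.inr (EReal.coe_ne_top m))]
  refine ⟨fun y => ?_, ?_, fun F hF => ?_, fun G hG => ?_⟩
  · rw [hm, sub_eq_add_neg, ← EReal.coe_neg, ← bot_lt_iff_ne_bot, EReal.bot_lt_add_iff]
    exact ⟨bot_lt_iff_ne_bot.2 (h.ne_bot y), EReal.bot_lt_coe _⟩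
  · simp only [hm, sub_eq_add_neg, ← EReal.coe_neg]
    exact h.lowerSemicontinuous.add' lowerSemicontinuous_const fun y =>
      EReal.continuousAt_add (Or.inr (EReal.coe_ne_bot _)) (Or.inr (EReal.coe_ne_top _))
  · have hFm : @MeasurableSet Y (borel Y) F := by
      rw [← compl_compl F]
      exact (measurableSet_borel_of_isOpen hF.isOpen_compl).compl
    rw [limsup_congr (heq F hFm), hneg]
    refine (EReal.limsup_add_le (Or.inr ?_) (Or.inr ?_)).trans
      (add_le_add (h.upper F hF) hlim.limsup_eq.le)
    · rw [hlim.limsup_eq]; exact EReal.coe_ne_top m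
    · rw [hlim.limsup_eq]; exact EReal.coe_ne_bot m
  · rw [liminf_congr (heq G (measurableSet_borel_of_isOpen hG)), hneg]
    exact (add_le_add (h.lower G hG) hlim.liminf_eq.ge).trans EReal.le_liminf_add

end Normalization

/-! ### Partition function and Gibbs measure -/

section Gibbs

variable {X : Type*} [MeasurableSpace X] {μ₀ : ProbabilityMeasure X}
  {H : (N : ℕ) → (Fin N → X) → EReal} {E : ProbabilityMeasure X → EReal} {b : EReal}

lemma boltzmannMeasure_univ (β : ℝ) (N : ℕ) :
    boltzmannMeasure μ₀ H β N Set.univ = partitionFunction μ₀ H β N := by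
  rw [boltzmannMeasure, withDensity_apply _ MeasurableSet.univ, Measure.restrict_univ]
  rfl

lemma isProbabilityMeasure_gibbsMeasure {β : ℝ} {N : ℕ} (h0 : partitionFunction μ₀ H β N ≠ 0)
    (ht : partitionFunction μ₀ H β N ≠ ∞) : IsProbabilityMeasure (gibbsMeasure μ₀ H β N) :=
  ⟨by rw [gibbsMeasure, Measure.smul_apply, boltzmannMeasure_univ, smul_eq_mul,
    ENNReal.inv_mul_cancel h0 ht]⟩

lemma iInf_freeEnergy_ne_top (h1 : HypH1 μ₀ H E) : ⨅ μ, freeEnergy μ₀ E b μ ≠ ⊤ := by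
  refine ((iInf_le _ μ₀).trans_lt ?_).ne
  rw [freeEnergy, klDiv_self]
  simpa using h1.reference_lt_top

variable [TopologicalSpace X] [CompactSpace X] [TopologicalSpace.MetrizableSpace X]

/-- A lower semicontinuous function on the compact space `𝓟(X)` attains its infimum. -/
lemma iInf_freeEnergy_ne_bot [BorelSpace X] (hlsc : LowerSemicontinuous (freeEnergy μ₀ E b))
    (hbot : ∀ μ, freeEnergy μ₀ E b μ ≠ ⊥) : ⨅ μ, freeEnergy μ₀ E b μ ≠ ⊥ := by
  obtain ⟨μ, -, hμ⟩ := (hlsc.lowerSemicontinuousOn Set.univ).exists_isMinOn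
    (Set.nonempty_of_mem (Set.mem_univ μ₀)) isCompact_univ
  have h : freeEnergy μ₀ E b μ ≤ ⨅ ν, freeEnergy μ₀ E b ν := le_iInf fun ν => hμ (Set.mem_univ ν)
  exact ((bot_lt_iff_ne_bot.2 (hbot μ)).trans_le h).ne'

end Gibbs

end GibbsLDP

open GibbsLDP in
theorem theorem3p1 {X : Type*} [TopologicalSpace X] [CompactSpace X]
    [TopologicalSpace.MetrizableSpace X] [MeasurableSpace X] [BorelSpace X] [Nonempty X]
    (μ₀ : ProbabilityMeasure X)
    (H : (N : ℕ) → (Fin N → X) → EReal)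
    (hHmeas : ∀ N, AEMeasurable (H N) (powMeasure N μ₀))
    (hHsymm : ∀ (N : ℕ) (σ : Equiv.Perm (Fin N)) (x : Fin N → X), H N (x ∘ σ) = H N x)
    (E : ProbabilityMeasure X → EReal)
    (h1 : HypH1 μ₀ H E) (h2' : HypH2' H E)
    (β : ℕ → ℝ) (hβpos : ∀ N, 0 < β N)
    (βlim : EReal) (hβlim_pos : 0 < βlim)
    (hβ : Tendsto (fun N => (β N : EReal)) atTop (𝓝 βlim))
    (h3 : βlim = ⊤ → HypH3 μ₀ E) :
    SatisfiesLDP (fun N => empiricalLaw N (boltzmannMeasure μ₀ H (β N) N))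
        (fun N => β N * N) (freeEnergy μ₀ E βlim) ∧
      (∀ᶠ N in atTop, IsProbabilityMeasure (gibbsMeasure μ₀ H (β N) N)) ∧
      SatisfiesLDP (fun N => empiricalLaw N (gibbsMeasure μ₀ H (β N) N))
        (fun N => β N * N)
        (fun μ => freeEnergy μ₀ E βlim μ - ⨅ ν, freeEnergy μ₀ E βlim ν) := by
  obtain ⟨t, ht, hb, hβt, hr, ht0⟩ := exists_tendsto_inv hβlim_pos hβ
  have hbot := freeEnergy_ne_bot (μ₀ := μ₀) h1.ne_bot hβlim_pos.le
  have hlsc := lowerSemicontinuous_freeEnergy (μ₀ := μ₀) (h1.lowerSemicontinuous h2') h1.ne_bot ht hb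
  have hLDP : SatisfiesLDP (fun N => empiricalLaw N (boltzmannMeasure μ₀ H (β N) N))
      (fun N => β N * N) (freeEnergy μ₀ E βlim) :=
    ⟨hbot, hlsc, fun F hF => limsup_log_boltzmannMeasure_le h2' hβpos ht hb hβt hr hF,
      fun G hG => le_liminf_log_boltzmannMeasure h1 h2' hβpos ht hb hβt hr
        (fun h => h3 (ht0 h)) hG⟩
  have hZ : ∀ N, empiricalLaw N (boltzmannMeasure μ₀ H (β N) N) Set.univ =
      partitionFunction μ₀ H (β N) N := fun N => by
    rw [empiricalLaw_apply _ _ (measurableSet_borel_of_isOpen isOpen_univ), ← boltzmannMeasure_univ]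
    rfl
  have hm : ⨅ μ, freeEnergy μ₀ E βlim μ = ((⨅ μ, freeEnergy μ₀ E βlim μ).toReal : EReal) :=
    (EReal.coe_toReal (iInf_freeEnergy_ne_top h1) (iInf_freeEnergy_ne_bot hlsc hbot)).symm
  have hr0 := hr.eventually_gt_atTop 0
  refine ⟨hLDP, ?_, hLDP.normalize hr0 hm fun N s hs => ?_⟩
  -- `Z_N = 0` or `Z_N = ∞` would make `log Z_N / (β_N N)` infinite, but it has a finite limit.
  · have hlim := hLDP.tendsto_log_univ
    rw [hm, ← EReal.coe_neg] at hlim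
    filter_upwards [hlim.eventually (lt_mem_nhds (EReal.bot_lt_coe _)),
      hlim.eventually (gt_mem_nhds (EReal.coe_lt_top _)), hr0] with N hN hN' hrN
    rw [hZ] at hN hN'
    have hrN' : (0 : EReal) < ((β N * N : ℝ) : EReal) := by exact_mod_cast hrN
    refine isProbabilityMeasure_gibbsMeasure (fun h => ?_) (fun h => ?_)
    · rw [h, ENNReal.log_zero, EReal.bot_div_of_pos_ne_top hrN' (EReal.coe_ne_top _)] at hN
      exact lt_irrefl _ hN
    · rw [h, ENNReal.log_top, EReal.top_div_of_pos_ne_top hrN' (EReal.coe_ne_top _)] at hN'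
      exact lt_irrefl _ hN'
  · rw [hZ, empiricalLaw_apply _ _ hs, empiricalLaw_apply _ _ hs, gibbsMeasure,
      Measure.smul_apply, smul_eq_mul]
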